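/- Let $\mathcal X,\mathcal U,\mathcal Y$ be complex Hilbert spaces and let $A:\mathcal X\to\mathcal X$, $B:\mathcal U\to\mathcal X$, $C:\mathcal X\to\mathcal Y$, $D:\mathcal U\to\mathcal Y$ be bounded linear operators, defining the discrete-time linear system $\Sigma$: $x(n+1)=Ax(n)+Bu(n)$, $y(n)=Cx(n)+Du(n)$ $(n\in\mathbb Z)$, with transfer function $F_\Sigma(z)=D+zC(I-zA)^{-1}B$. Assume that $A$ has a dichotomy, i.e. the spectrum of $A$ does not meet the unit circle $\mathbb T$. For a selfadjoint operator $T$ on a Hilbert space write $T\succ 0$ if there is a $\delta>0$ with $\langle Tx,x\rangle\ge\delta\|x\|^2$ for all $x$, and write $S\prec T$ if $T-S\succ0$. Then the following are equivalent: 1. $\sup_{z\in\mathbb T}\|F_\Sigma(z)\|<1$. 2. There is a bounded and boundedly invertible selfadjoint operator $H$ on $\mathcal X$ satisfying the strict KYP inequality $$\begin{bmatrix}A&B\\C&D\end{bmatrix}^*\begin{bmatrix}H&0\\0&I_{\mathcal Y}\end{bmatrix}\begin{bmatrix}A&B\\C&D\end{bmatrix}\prec\begin{bmatrix}H&0\\0&I_{\mathcal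 U}\end{bmatrix}.$$ Moreover, for every bounded, boundedly invertible selfadjoint $H$ satisfying this inequality, the (Hilbert space) dimension of the spectral subspace of $A$ over the open unit disk equals the dimension of the spectral subspace of $H$ over the positive real line, and the dimension of the spectral subspace of $A$ over the exterior of the closed unit disk equals the dimension of the spectral subspace of $H$ over the negative real line. -/

import Mathlib

open scoped ENNReal InnerProductSpace

noncomputable section

/-- The discrete-time linear system `x(n+1) = A x(n) + B u(n)`, `y(n) = C x(n) + D u(n)` with
state space `X`, input space `U`, output space `Y` and bounded operators `A, B, C, D`. -/
structure DTSystem (X U Y : Type*)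
    [NormedAddCommGroup X] [InnerProductSpace ℂ X]
    [NormedAddCommGroup U] [InnerProductSpace ℂ U]
    [NormedAddCommGroup Y] [InnerProductSpace ℂ Y] where
  A : X →L[ℂ] X
  B : U →L[ℂ] X
  C : X →L[ℂ] Y
  D : U →L[ℂ] Y

/-- The operator `A` admits a dichotomy: it has no spectrum on the unit circle. -/
def HasDichotomy {X : Type*} [NormedAddCommGroup X] [InnerProductSpace ℂ X]
    (A : X →L[ℂ] X) : Prop :=
  Disjoint (spectrum ℂ A) (Metric.sphere (0 : ℂ) 1)

/-- The block operator `[P Q; R S] : E ⊕ F → G ⊕ K` between orthogonal (Hilbert) direct sums,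
`(x, u) ↦ (P x + Q u, R x + S u)`. -/
def blockOp {E F G K : Type*}
    [NormedAddCommGroup E] [InnerProductSpace ℂ E]
    [NormedAddCommGroup F] [InnerProductSpace ℂ F]
    [NormedAddCommGroup G] [InnerProductSpace ℂ G]
    [NormedAddCommGroup K] [InnerProductSpace ℂ K]
    (P : E →L[ℂ] G) (Q : F →L[ℂ] G) (R : E →L[ℂ] K) (S : F →L[ℂ] K) :
    WithLp 2 (E × F) →L[ℂ] WithLp 2 (G × K) :=
  ((WithLp.prodContinuousLinearEquiv 2 ℂ G K).symm : (G × K) →L[ℂ] WithLp 2 (G × K)) ∘L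
    ((P.coprod Q).prod (R.coprod S)) ∘L
    ((WithLp.prodContinuousLinearEquiv 2 ℂ E F) : WithLp 2 (E × F) →L[ℂ] (E × F))

/-- `T ≻ 0` for a bounded operator `T` on a Hilbert space: `T` is selfadjoint and
`⟨T x, x⟩ ≥ δ ‖x‖²` for all `x`, for some `δ > 0`. -/
def StrictlyPosDef {E : Type*} [NormedAddCommGroup E] [InnerProductSpace ℂ E] [CompleteSpace E]
    (T : E →L[ℂ] E) : Prop :=
  IsSelfAdjoint T ∧ ∃ δ : ℝ, 0 < δ ∧ ∀ x : E, δ * ‖x‖ ^ 2 ≤ (⟪T x, x⟫_ℂ).re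

/-- The Hilbert space dimension: the cardinality of an orthonormal basis (all orthonormal bases
of a Hilbert space have the same cardinality). -/
def hilbertDim (E : Type*) [NormedAddCommGroup E] [InnerProductSpace ℂ E] : Cardinal :=
  sInf {c | ∃ w : Set E, Nonempty (HilbertBasis w ℂ E) ∧ Cardinal.mk w = c}

/-- The Riesz projection `(2πi)⁻¹ ∮_{|z|=1} (zI - A)⁻¹ dz` of `A` for the open unit disk. -/
def diskRieszProj {X : Type*} [NormedAddCommGroup X] [InnerProductSpace ℂ X]
    (A : X →L[ℂ] X) : X →L[ℂ] X :=
  (2 * Real.pi * Complex.I : ℂ)⁻¹ • ∮ z in C(0, 1), resolvent A z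

/-- The spectral subspace of `A` over the open unit disk. -/
def spectralSubspaceDisk {X : Type*} [NormedAddCommGroup X] [InnerProductSpace ℂ X]
    (A : X →L[ℂ] X) : Submodule ℂ X :=
  LinearMap.range (diskRieszProj A : X →ₗ[ℂ] X)

/-- The spectral subspace of `A` over the exterior of the closed unit disk, for an operator `A`
without spectrum on the unit circle: the range of the complementary Riesz projection. -/
def spectralSubspaceExterior {X : Type*} [NormedAddCommGroup X] [InnerProductSpace ℂ X]
    (A : X →L[ℂ] X) : Submodule ℂ X :=
  LinearMap.range ((1 - diskRieszProj A : X →L[ℂ] X) : X →ₗ[ℂ] X)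

open Classical in
/-- The spectral subspace over the positive real line of an invertible selfadjoint operator `H`:
the range of `χ(H)`, where `χ` is the indicator function of `(0, ∞)`. As `0` is not in the
spectrum, `χ` is continuous on the spectrum. -/
def spectralSubspacePos {X : Type*} [NormedAddCommGroup X] [InnerProductSpace ℂ X]
    [CompleteSpace X] (H : X →L[ℂ] X) : Submodule ℂ X :=
  LinearMap.range ((cfc (fun t : ℝ => if 0 < t then (1 : ℝ) else 0) H : X →L[ℂ] X) : X →ₗ[ℂ] X)

open Classical in
/-- The spectral subspace over the negative real line of an invertible selfadjoint operator. -/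
def spectralSubspaceNeg {X : Type*} [NormedAddCommGroup X] [InnerProductSpace ℂ X]
    [CompleteSpace X] (H : X →L[ℂ] X) : Submodule ℂ X :=
  LinearMap.range ((cfc (fun t : ℝ => if t < 0 then (1 : ℝ) else 0) H : X →L[ℂ] X) : X →ₗ[ℂ] X)

/-- The inertia of `A` with respect to the unit circle matches the inertia of the invertible
selfadjoint operator `H` with respect to the point `0` of the real line. -/
def InertiaMatches {X : Type*} [NormedAddCommGroup X] [InnerProductSpace ℂ X]
    [CompleteSpace X] (A H : X →L[ℂ] X) : Prop :=
  hilbertDim (spectralSubspaceDisk A) = hilbertDim (spectralSubspacePos H) ∧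
    hilbertDim (spectralSubspaceExterior A) = hilbertDim (spectralSubspaceNeg H)

namespace DTSystem

variable {X U Y : Type*}
  [NormedAddCommGroup X] [InnerProductSpace ℂ X]
  [NormedAddCommGroup U] [InnerProductSpace ℂ U]
  [NormedAddCommGroup Y] [InnerProductSpace ℂ Y]

/-- The transfer function `F(z) = D + z C (I - zA)⁻¹ B`. -/
def transferFunction (S : DTSystem X U Y) (z : ℂ) : U →L[ℂ] Y :=
  S.D + z • (S.C ∘L Ring.inverse (1 - z • S.A) ∘L S.B)

/-- `sup_{|z| = 1} ‖F(z)‖`, as an extended nonnegative real number. -/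
def transferSupNorm (S : DTSystem X U Y) : ℝ≥0∞ :=
  ⨆ z ∈ Metric.sphere (0 : ℂ) 1, ‖S.transferFunction z‖ₑ

/-- The system matrix `[A B; C D] : X ⊕ U → X ⊕ Y`. -/
def systemMatrix (S : DTSystem X U Y) : WithLp 2 (X × U) →L[ℂ] WithLp 2 (X × Y) :=
  blockOp S.A S.B S.C S.D

/-- The strict KYP inequality
`[A B; C D]* [H 0; 0 I_Y] [A B; C D] ≺ [H 0; 0 I_U]`. -/
def StrictKYP [CompleteSpace X] [CompleteSpace U] [CompleteSpace Y]
    (S : DTSystem X U Y) (H : X →L[ℂ] X) : Prop :=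
  StrictlyPosDef
    (blockOp H 0 0 (1 : U →L[ℂ] U) -
      ContinuousLinearMap.adjoint S.systemMatrix ∘L blockOp H 0 0 (1 : Y →L[ℂ] Y) ∘L
        S.systemMatrix)

end DTSystem

end

/-!
Write the strict KYP inequality as the dissipation inequality
`⟨H(Ax+Bu), Ax+Bu⟩ + ‖Cx+Du‖² + δ(‖x‖² + ‖u‖²) ≤ ⟨Hx, x⟩ + ‖u‖²`.

If it holds and `|z| = 1`, then evaluating it at `x = (z⁻¹ - A)⁻¹ B u` makes the two `H`-terms cancel
and leaves `‖F(z)u‖² ≤ (1 - δ)‖u‖²` (`DTSystem.transferSupNorm_lt_one_of_strictKYP`).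

Conversely, on the circle a strict bound on `‖F‖` gives
`‖Cx+Du‖² + ε(‖x‖² + ‖u‖²) ≤ ‖u‖² + κ ‖ωx - Ax - Bu‖²` for all `x` and `u`, with `ε` small and `κ`
large (`DTSystem.exists_frequency_inequality`). Parseval's identity for the finite Fourier transform
carries this over to finitely supported sequences `(xₙ, uₙ)` with `x₀ = 0`, where `ωx` becomes the
shifted sequence. So the payoff
`∑ₙ ‖Cxₙ+Duₙ‖² + ε'(‖xₙ‖² + ‖uₙ‖²) - ‖uₙ‖² - κ ‖xₙ₊₁ - Axₙ - Buₙ‖²` with `ε' = ε/2` is a bounded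
quadratic form on square summable sequences that is uniformly negative on those with `x₀ = 0`. Its
maximum over the sequences with prescribed `x₀` is a bounded quadratic form `⟨Hx₀, x₀⟩`
(`exists_fibrewise_max_quadForm`), and prepending `(x, u)` to a maximizer for `Ax + Bu` is the
dissipation inequality. The penalty in place of the state equation makes every initial state
admissible, so that no controllability is needed.

For the inertia, let `P` be the Riesz projection of `A` for the disk. The moments
`Pₙ = (2πi)⁻¹ ∮ zⁿ (z - A)⁻¹ dz` satisfy `Aⁿ P = Pₙ` and `Aⁿ P₋ₙ = P - 1` (for `n > 0`), and tend to
zero by the Riemann–Lebesgue lemma. Hence `P` is idempotent, forward orbits in `Ran P` tend to zero,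
and points of `Ran (1 - P)` have backward orbits tending to zero. As `⟨Hx, x⟩` decreases strictly
along orbits, `H` is uniformly positive on `Ran P` and uniformly negative on `Ran (1 - P)`. This
forces `H` to be invertible (`isUnit_of_definite_splitting`) and makes the spectral projections of
`H` restrict to isomorphisms between corresponding subspaces
(`hilbertDim_range_eq_of_definite_splitting`). Linearly homeomorphic Hilbert spaces are isometric by
polar decomposition, so the dimensions agree.
-/

/-! ### Preliminaries on bounded operators between Hilbert spaces -/

section Prelim

variable {E F : Type*} [NormedAddCommGroup E] [InnerProductSpace ℂ E] [CompleteSpace E]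
  [NormedAddCommGroup F] [InnerProductSpace ℂ F] [CompleteSpace F]

/-- A bounded operator that is bounded below and has dense range is bijective; density is expressed
as triviality of the orthogonal complement of the range. -/
theorem bijective_of_bounded_below_of_dense (T : E →L[ℂ] F) {c : ℝ} (hc : 0 < c)
    (hT : ∀ x, c * ‖x‖ ≤ ‖T x‖) (hd : ∀ w, (∀ x, ⟪T x, w⟫_ℂ = 0) → w = 0) :
    Function.Bijective T := by
  have hanti : AntilipschitzWith (Real.toNNReal c⁻¹) T := by
    refine T.antilipschitz_of_bound fun x => ?_
    rw [Real.coe_toNNReal _ (inv_nonneg.2 hc.le), ← div_eq_inv_mul, le_div_iff₀ hc, mul_comm]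
    exact hT x
  refine ⟨hanti.injective, ?_⟩
  have hcl : IsClosed (LinearMap.range (T : E →ₗ[ℂ] F) : Set F) := by
    exact hanti.isClosed_range T.uniformContinuous
  have := hcl.completeSpace_coe
  have htop : LinearMap.range (T : E →ₗ[ℂ] F) = ⊤ := by
    rw [← Submodule.orthogonal_eq_bot_iff, eq_bot_iff]
    intro w hw
    rw [Submodule.mem_orthogonal] at hw
    exact (Submodule.mem_bot ℂ).2 (hd w fun x => hw (T x) ⟨x, rfl⟩)
  exact LinearMap.range_eq_top.1 htop

theorem isUnit_of_coercive (T : E →L[ℂ] E) {c : ℝ} (hc : 0 < c)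
    (hT : ∀ x, c * ‖x‖ ^ 2 ≤ (⟪T x, x⟫_ℂ).re) : IsUnit T := by
  refine ContinuousLinearMap.isUnit_iff_bijective.2 (bijective_of_bounded_below_of_dense T hc ?_ ?_)
  · intro x
    rcases eq_or_ne x 0 with rfl | hx
    · simp
    · have hpos : 0 < ‖x‖ := norm_pos_iff.2 hx
      have h1 := (hT x).trans ((Complex.re_le_norm _).trans (norm_inner_le_norm (T x) x))
      nlinarith
  · intro w hw
    have h1 := hT w
    rw [hw w] at h1
    have h2 : ‖w‖ ^ 2 ≤ 0 := by simp at h1; nlinarith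
    simpa using h2

theorem inner_isSelfAdjoint {H : E →L[ℂ] E} (hH : IsSelfAdjoint H) (x y : E) :
    ⟪H x, y⟫_ℂ = ⟪x, H y⟫_ℂ := hH.isSymmetric x y

end Prelim

/-! ### The quadratic form of the strict KYP inequality -/

section KYP

variable {X U Y : Type*}
  [NormedAddCommGroup X] [InnerProductSpace ℂ X]
  [NormedAddCommGroup U] [InnerProductSpace ℂ U]
  [NormedAddCommGroup Y] [InnerProductSpace ℂ Y]

section Block

variable {E F G K : Type*}
    [NormedAddCommGroup E] [InnerProductSpace ℂ E]
    [NormedAddCommGroup F] [InnerProductSpace ℂ F]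
    [NormedAddCommGroup G] [InnerProductSpace ℂ G]
    [NormedAddCommGroup K] [InnerProductSpace ℂ K]

@[simp] theorem blockOp_apply_fst (P : E →L[ℂ] G) (Q : F →L[ℂ] G) (R : E →L[ℂ] K) (S : F →L[ℂ] K)
    (v : WithLp 2 (E × F)) : (blockOp P Q R S v).fst = P v.fst + Q v.snd := by
  simp [blockOp]

@[simp] theorem blockOp_apply_snd (P : E →L[ℂ] G) (Q : F →L[ℂ] G) (R : E →L[ℂ] K) (S : F →L[ℂ] K)
    (v : WithLp 2 (E × F)) : (blockOp P Q R S v).snd = R v.fst + S v.snd := by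
  simp [blockOp]

theorem isSelfAdjoint_blockOp_diag [CompleteSpace E] [CompleteSpace F] {H : E →L[ℂ] E}
    (hH : IsSelfAdjoint H) : IsSelfAdjoint (blockOp H 0 0 (1 : F →L[ℂ] F)) := by
  rw [ContinuousLinearMap.isSelfAdjoint_iff_isSymmetric]
  intro x y
  simp only [ContinuousLinearMap.coe_coe, WithLp.prod_inner_apply]
  have h1 := blockOp_apply_fst H 0 0 (1 : F →L[ℂ] F)
  have h2 := blockOp_apply_snd H 0 0 (1 : F →L[ℂ] F)
  simp only [WithLp.fst, WithLp.snd] at h1 h2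
  rw [h1, h1, h2, h2]
  simp [inner_isSelfAdjoint hH]

end Block

theorem norm_sq_withLp_prod {X U : Type*} [NormedAddCommGroup X] [NormedAddCommGroup U]
    (v : WithLp 2 (X × U)) : ‖v‖ ^ 2 = ‖v.fst‖ ^ 2 + ‖v.snd‖ ^ 2 :=
  WithLp.prod_norm_sq_eq_of_L2 v

theorem inner_withLp_prod (a b : WithLp 2 (X × U)) :
    ⟪a, b⟫_ℂ = ⟪a.fst, b.fst⟫_ℂ + ⟪a.snd, b.snd⟫_ℂ := rfl

theorem re_inner_self_eq_norm_sq (x : X) : (⟪x, x⟫_ℂ).re = ‖x‖ ^ 2 := by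
  simp [inner_self_eq_norm_sq_to_K, ← Complex.ofReal_pow]

variable [CompleteSpace X] [CompleteSpace U] [CompleteSpace Y]

/-- The strict KYP inequality as a dissipation inequality with storage function `⟨Hx, x⟩`. -/
theorem DTSystem.strictKYP_iff (S : DTSystem X U Y) {H : X →L[ℂ] X} (hH : IsSelfAdjoint H) :
    S.StrictKYP H ↔ ∃ δ : ℝ, 0 < δ ∧ ∀ (x : X) (u : U),
      (⟪H (S.A x + S.B u), S.A x + S.B u⟫_ℂ).re + ‖S.C x + S.D u‖ ^ 2 +
        δ * (‖x‖ ^ 2 + ‖u‖ ^ 2) ≤ (⟪H x, x⟫_ℂ).re + ‖u‖ ^ 2 := by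
  have hform : ∀ v : WithLp 2 (X × U), (⟪(blockOp H 0 0 (1 : U →L[ℂ] U) -
      ContinuousLinearMap.adjoint S.systemMatrix ∘L blockOp H 0 0 (1 : Y →L[ℂ] Y) ∘L
        S.systemMatrix) v, v⟫_ℂ).re = (⟪H v.fst, v.fst⟫_ℂ).re + ‖v.snd‖ ^ 2 -
      ((⟪H (S.A v.fst + S.B v.snd), S.A v.fst + S.B v.snd⟫_ℂ).re +
        ‖S.C v.fst + S.D v.snd‖ ^ 2) := by
    intro v
    rw [sub_apply, inner_sub_left, ContinuousLinearMap.comp_apply,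
      ContinuousLinearMap.adjoint_inner_left, Complex.sub_re,
      inner_withLp_prod, ContinuousLinearMap.comp_apply, inner_withLp_prod]
    simp [DTSystem.systemMatrix, ← Complex.ofReal_pow]
  have hsa : IsSelfAdjoint (blockOp H 0 0 (1 : U →L[ℂ] U) -
      ContinuousLinearMap.adjoint S.systemMatrix ∘L blockOp H 0 0 (1 : Y →L[ℂ] Y) ∘L
        S.systemMatrix) :=
    (isSelfAdjoint_blockOp_diag hH).sub
      ((isSelfAdjoint_blockOp_diag (F := Y) hH).adjoint_conj S.systemMatrix)
  constructor
  · rintro ⟨-, δ, hδ, h⟩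
    refine ⟨δ, hδ, fun x u => ?_⟩
    have := h (WithLp.toLp 2 (x, u))
    rw [hform, norm_sq_withLp_prod] at this
    simp only [WithLp.toLp_fst, WithLp.toLp_snd] at this
    linarith
  · rintro ⟨δ, hδ, h⟩
    refine ⟨hsa, δ, hδ, fun v => ?_⟩
    have := h v.fst v.snd
    rw [hform, norm_sq_withLp_prod]
    linarith

end KYP

/-! ### Resolvents on the unit circle and the transfer function -/

section Circle

variable {X U Y : Type*}
  [NormedAddCommGroup X] [InnerProductSpace ℂ X]
  [NormedAddCommGroup U] [InnerProductSpace ℂ U]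
  [NormedAddCommGroup Y] [InnerProductSpace ℂ Y]

theorem HasDichotomy.mem_resolventSet {A : X →L[ℂ] X} (hA : HasDichotomy A) {z : ℂ}
    (hz : ‖z‖ = 1) : z ∈ resolventSet ℂ A := by
  by_contra h
  exact Set.disjoint_left.1 hA h (by simpa using hz)

theorem HasDichotomy.mul_resolvent {A : X →L[ℂ] X} (hA : HasDichotomy A) {z : ℂ}
    (hz : ‖z‖ = 1) : A * resolvent A z = z • resolvent A z - 1 := by
  have h := Ring.mul_inverse_cancel _ (hA.mem_resolventSet hz)
  rw [sub_mul, Algebra.algebraMap_eq_smul_one, smul_one_mul] at h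
  rw [resolvent, ← Algebra.algebraMap_eq_smul_one] at *
  rw [← h]; abel

theorem HasDichotomy.resolvent_mul {A : X →L[ℂ] X} (hA : HasDichotomy A) {z : ℂ}
    (hz : ‖z‖ = 1) : resolvent A z * A = z • resolvent A z - 1 := by
  have h := Ring.inverse_mul_cancel _ (hA.mem_resolventSet hz)
  rw [mul_sub, Algebra.algebraMap_eq_smul_one, mul_smul_one] at h
  rw [resolvent, ← Algebra.algebraMap_eq_smul_one] at *
  rw [← h]; abel

theorem HasDichotomy.continuousOn_resolvent [CompleteSpace X] {A : X →L[ℂ] X}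
    (hA : HasDichotomy A) : ContinuousOn (resolvent A) (Metric.sphere (0 : ℂ) 1) := by
  intro z hz
  exact ((spectrum.hasDerivAt_resolvent_const_left
    (hA.mem_resolventSet (by simpa using hz))).continuousAt).continuousWithinAt

theorem HasDichotomy.exists_resolvent_bound [CompleteSpace X] {A : X →L[ℂ] X}
    (hA : HasDichotomy A) : ∃ M : ℝ, 0 < M ∧ ∀ z : ℂ, ‖z‖ = 1 → ‖resolvent A z‖ ≤ M := by
  obtain ⟨M, hM⟩ := (isCompact_sphere (0 : ℂ) 1).exists_bound_of_continuousOn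
    hA.continuousOn_resolvent
  exact ⟨max M 1, by positivity, fun z hz => (hM z (by simpa using hz)).trans (le_max_left _ _)⟩

/-- On the unit circle `z (I - zA)⁻¹` is the resolvent of `A` at `z⁻¹`. -/
theorem HasDichotomy.transferFunction_inv {S : DTSystem X U Y} (hA : HasDichotomy S.A) {w : ℂ}
    (hw : ‖w‖ = 1) : S.transferFunction w⁻¹ = S.D + S.C ∘L resolvent S.A w ∘L S.B := by
  have hw0 : w ≠ 0 := by rintro rfl; simp at hw
  have h : Ring.inverse (1 - w⁻¹ • S.A) = w • resolvent S.A w := by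
    have e : (1 - w⁻¹ • S.A) = w⁻¹ • (algebraMap ℂ (X →L[ℂ] X) w - S.A) := by
      rw [smul_sub, Algebra.algebraMap_eq_smul_one, smul_smul, inv_mul_cancel₀ hw0, one_smul]
    have hR1 := Ring.mul_inverse_cancel _ (hA.mem_resolventSet hw)
    have hR2 := Ring.inverse_mul_cancel _ (hA.mem_resolventSet hw)
    refine Ring.inverse_unit (⟨1 - w⁻¹ • S.A, w • resolvent S.A w, ?_, ?_⟩ : (X →L[ℂ] X)ˣ)
    all_goals rw [e, resolvent, smul_mul_smul_comm]; simp [hw0, hR1, hR2]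
  rw [DTSystem.transferFunction, h]
  ext u
  simp [smul_smul, hw0]

theorem enorm_transferFunction_le (S : DTSystem X U Y) {z : ℂ} (hz : ‖z‖ = 1) :
    ‖S.transferFunction z‖ₑ ≤ S.transferSupNorm :=
  le_iSup₂_of_le (f := fun z (_ : z ∈ Metric.sphere (0 : ℂ) 1) => ‖S.transferFunction z‖ₑ) z
    (by simpa using hz) le_rfl

/-- Evaluating the dissipation inequality at the periodic trajectory `x = (z⁻¹ - A)⁻¹ B u`, which
satisfies `Ax + Bu = z⁻¹ x`, cancels the storage terms and bounds `F(z) u`. -/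
theorem DTSystem.transferSupNorm_lt_one_of_strictKYP
    [CompleteSpace X] [CompleteSpace U] [CompleteSpace Y]
    (S : DTSystem X U Y) (hA : HasDichotomy S.A) {H : X →L[ℂ] X} (hH : IsSelfAdjoint H)
    (hK : S.StrictKYP H) : S.transferSupNorm < 1 := by
  obtain ⟨δ, hδ, h⟩ := (S.strictKYP_iff hH).1 hK
  set γ := Real.sqrt (max (1 - δ) 0) with hγ
  have hγ1 : γ < 1 := by
    rw [hγ, Real.sqrt_lt' one_pos]
    simp [hδ]
  have hγ0 : 0 ≤ γ := Real.sqrt_nonneg _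
  refine lt_of_le_of_lt (b := ENNReal.ofReal γ) ?_ (by simpa using hγ1)
  refine iSup₂_le fun z hz => ?_
  have hz1 : ‖z‖ = 1 := by simpa using hz
  have hw : ‖z⁻¹‖ = 1 := by simp [hz1]
  rw [← ofReal_norm]
  refine ENNReal.ofReal_le_ofReal (ContinuousLinearMap.opNorm_le_bound _ hγ0 fun u => ?_)
  have hF := hA.transferFunction_inv hw
  rw [inv_inv] at hF
  set x := resolvent S.A z⁻¹ (S.B u) with hx
  have hAx : S.A x + S.B u = z⁻¹ • x := by
    have := congrArg (fun T : X →L[ℂ] X => T (S.B u)) (hA.mul_resolvent hw)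
    simp only [mul_apply_eq_comp, sub_apply,
      smul_apply, one_apply_eq_self] at this
    rw [← hx] at this
    rw [this]; abel
  have hy : S.C x + S.D u = S.transferFunction z u := by
    rw [hF]; simp [hx, add_comm]
  have hk := h x u
  have hzz : (⟪H (z⁻¹ • x), z⁻¹ • x⟫_ℂ) = ⟪H x, x⟫_ℂ := by
    rw [map_smul, inner_smul_left, inner_smul_right, ← mul_assoc, Complex.conj_mul', hw]
    simp
  rw [hAx, hy, hzz] at hk
  have h2 : ‖S.transferFunction z u‖ ^ 2 ≤ (γ * ‖u‖) ^ 2 := by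
    rw [mul_pow, hγ, Real.sq_sqrt (le_max_right _ _)]
    have : (1 - δ) * ‖u‖ ^ 2 ≤ max (1 - δ) 0 * ‖u‖ ^ 2 := by gcongr; exact le_max_left _ _
    nlinarith [sq_nonneg ‖x‖]
  exact le_of_sq_le_sq h2 (by positivity)

end Circle

/-! ### The Riesz projection and the moments of the resolvent -/

section Riesz

variable {X : Type*} [NormedAddCommGroup X] [InnerProductSpace ℂ X]

/-- The moment `(2πi)⁻¹ ∮_{|z|=1} zⁿ (zI - A)⁻¹ dz` of the resolvent, for an integer `n`. -/
noncomputable def rieszMoment (A : X →L[ℂ] X) (n : ℤ) : X →L[ℂ] X :=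
  (2 * Real.pi * Complex.I : ℂ)⁻¹ • ∮ z in C(0, 1), z ^ n • resolvent A z

theorem rieszMoment_zero (A : X →L[ℂ] X) : rieszMoment A 0 = diskRieszProj A := by
  simp [rieszMoment, diskRieszProj]

theorem continuousOn_zpow_sphere (n : ℤ) :
    ContinuousOn (fun z : ℂ => z ^ n) (Metric.sphere 0 1) := by
  intro z hz
  refine (continuousAt_zpow₀ z n (Or.inl ?_)).continuousWithinAt
  rintro rfl
  simp at hz

variable [CompleteSpace X] {A : X →L[ℂ] X}

theorem HasDichotomy.circleIntegrable_zpow_smul_resolvent (hA : HasDichotomy A) (n : ℤ) :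
    CircleIntegrable (fun z => z ^ n • resolvent A z) 0 1 := by
  exact ContinuousOn.circleIntegrable zero_le_one
    ((continuousOn_zpow_sphere n).fun_smul hA.continuousOn_resolvent)

theorem circleIntegral_zpow_smul_one (n : ℤ) :
    (2 * Real.pi * Complex.I : ℂ)⁻¹ • (∮ z in C(0, 1), z ^ n • (1 : X →L[ℂ] X)) =
      if n = -1 then 1 else 0 := by
  rw [circleIntegral.integral_smul_const]
  split_ifs with h
  · have := circleIntegral.integral_sub_center_inv (0 : ℂ) (one_ne_zero (α := ℝ))
    simp only [sub_zero] at this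
    rw [h]
    simp only [zpow_neg_one, this]
    rw [inv_smul_smul₀ (by simp [Real.pi_ne_zero])]
  · have := circleIntegral.integral_sub_zpow_of_ne h 0 0 1
    simp only [sub_zero] at this
    rw [this]; simp

/-- Multiplying the integrand by `A` on either side turns `zⁿ (z - A)⁻¹` into
`zⁿ⁺¹ (z - A)⁻¹ - zⁿ`; the map `L` stands for the left or the right multiplication. -/
theorem HasDichotomy.map_rieszMoment (hA : HasDichotomy A) (n : ℤ)
    (L : (X →L[ℂ] X) →L[ℂ] (X →L[ℂ] X))
    (hL : ∀ z : ℂ, ‖z‖ = 1 → L (resolvent A z) = z • resolvent A z - 1) :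
    L (rieszMoment A n) = rieszMoment A (n + 1) - if n = -1 then 1 else 0 := by
  have hint := hA.circleIntegrable_zpow_smul_resolvent n
  have h1 : L (∮ z in C(0, 1), z ^ n • resolvent A z) =
      ∮ z in C(0, 1), (z ^ (n + 1) • resolvent A z - z ^ n • (1 : X →L[ℂ] X)) := by
    rw [circleIntegral, ← ContinuousLinearMap.intervalIntegral_comp_comm L hint.out]
    rw [circleIntegral]
    refine intervalIntegral.integral_congr fun θ _ => ?_
    have hz : ‖circleMap 0 1 θ‖ = 1 := by simp
    have hz0 : circleMap 0 1 θ ≠ 0 := by intro h; simp [h] at hz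
    simp only [map_smul]
    rw [hL _ hz, zpow_add_one₀ hz0, smul_sub, smul_smul]
  have h2 : CircleIntegrable (fun z => z ^ n • (1 : X →L[ℂ] X)) 0 1 := by
    exact ContinuousOn.circleIntegrable zero_le_one
      ((continuousOn_zpow_sphere n).fun_smul continuousOn_const)
  rw [rieszMoment, map_smul, h1, circleIntegral.integral_sub
    (hA.circleIntegrable_zpow_smul_resolvent (n + 1)) h2, smul_sub, circleIntegral_zpow_smul_one]
  rfl

theorem HasDichotomy.mul_rieszMoment (hA : HasDichotomy A) (n : ℤ) :
    A * rieszMoment A n = rieszMoment A (n + 1) - if n = -1 then 1 else 0 :=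
  hA.map_rieszMoment n (ContinuousLinearMap.mul ℂ (X →L[ℂ] X) A) fun _ hz => hA.mul_resolvent hz

theorem HasDichotomy.rieszMoment_mul (hA : HasDichotomy A) (n : ℤ) :
    rieszMoment A n * A = rieszMoment A (n + 1) - if n = -1 then 1 else 0 :=
  hA.map_rieszMoment n ((ContinuousLinearMap.mul ℂ (X →L[ℂ] X)).flip A)
    fun _ hz => hA.resolvent_mul hz

theorem HasDichotomy.pow_mul_diskRieszProj (hA : HasDichotomy A) (n : ℕ) :
    A ^ n * diskRieszProj A = rieszMoment A n := by
  induction n with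
  | zero => simp [rieszMoment_zero]
  | succ n ih =>
    rw [pow_succ', mul_assoc, ih, hA.mul_rieszMoment, if_neg (by omega), sub_zero]
    simp

theorem HasDichotomy.diskRieszProj_mul_pow (hA : HasDichotomy A) (n : ℕ) :
    diskRieszProj A * A ^ n = rieszMoment A n := by
  induction n with
  | zero => simp [rieszMoment_zero]
  | succ n ih =>
    rw [pow_succ, ← mul_assoc, ih, hA.rieszMoment_mul, if_neg (by omega), sub_zero]
    simp

theorem HasDichotomy.mul_rieszMoment_neg_one (hA : HasDichotomy A) :
    A * rieszMoment A (-1) = diskRieszProj A - 1 := by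
  simpa [rieszMoment_zero] using hA.mul_rieszMoment (-1)

theorem HasDichotomy.mul_rieszMoment_neg (hA : HasDichotomy A) (n : ℕ) :
    A * rieszMoment A (-((n + 1 : ℕ) : ℤ) - 1) = rieszMoment A (-(n : ℤ) - 1) := by
  rw [hA.mul_rieszMoment, if_neg (by push_cast; omega), sub_zero]
  congr 1; push_cast; ring

theorem HasDichotomy.pow_mul_rieszMoment_neg (hA : HasDichotomy A) (n : ℕ) :
    A ^ (n + 1) * rieszMoment A (-(n : ℤ) - 1) = diskRieszProj A - 1 := by
  induction n with
  | zero => simpa using hA.mul_rieszMoment_neg_one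
  | succ n ih => rw [pow_succ, mul_assoc, hA.mul_rieszMoment_neg, ih]

/-- The moments are the Fourier coefficients of a continuous operator valued function, so they
tend to zero by the Riemann–Lebesgue lemma. -/
theorem tendsto_rieszMoment (A : X →L[ℂ] X) :
    Filter.Tendsto (rieszMoment A) Filter.cofinite (nhds 0) := by
  set f : ℝ → X →L[ℂ] X := fun θ =>
    (Set.Ioc (0 : ℝ) (2 * Real.pi)).indicator
      (fun θ => deriv (circleMap 0 1) θ • resolvent A (circleMap 0 1 θ)) θ with hf
  have hRL := Real.tendsto_integral_exp_smul_cocompact f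
  have hg : Filter.Tendsto (fun n : ℤ => (n : ℝ) * (-(2 * Real.pi)⁻¹)) Filter.cofinite
      (Filter.cocompact ℝ) := by
    have h1 : Filter.Tendsto (fun n : ℤ => (n : ℝ)) Filter.cofinite (Filter.cocompact ℝ) :=
      Int.tendsto_coe_cofinite
    have h2 : Filter.Tendsto (fun x : ℝ => x * (-(2 * Real.pi)⁻¹)) (Filter.cocompact ℝ)
        (Filter.cocompact ℝ) :=
      (Homeomorph.mulRight₀ (-(2 * Real.pi)⁻¹)
        (by simp [Real.pi_ne_zero])).isClosedEmbedding.tendsto_cocompact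
    exact h2.comp h1
  have hcomp := (hRL.comp hg).const_smul ((2 * Real.pi * Complex.I : ℂ)⁻¹)
  rw [smul_zero] at hcomp
  refine hcomp.congr fun n => ?_
  simp only [Function.comp]
  rw [rieszMoment, circleIntegral, intervalIntegral.integral_of_le Real.two_pi_pos.le,
    ← MeasureTheory.integral_indicator measurableSet_Ioc]
  congr 2
  ext1 θ
  by_cases hθ : θ ∈ Set.Ioc (0 : ℝ) (2 * Real.pi)
  · simp only [hf, Set.indicator_of_mem hθ, Circle.smul_def]
    rw [smul_comm]
    congr 2
    rw [Real.fourierChar_apply, circleMap_zero, Complex.ofReal_one, one_mul, ← Complex.exp_int_mul]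
    congr 1
    have : (Real.pi : ℂ) ≠ 0 := by simp [Real.pi_ne_zero]
    push_cast
    field_simp
  · simp [hf, Set.indicator_of_notMem hθ]

theorem tendsto_rieszMoment_nat (A : X →L[ℂ] X) :
    Filter.Tendsto (fun n : ℕ => rieszMoment A n) Filter.atTop (nhds 0) := by
  rw [← Nat.cofinite_eq_atTop]
  exact (tendsto_rieszMoment A).comp (Nat.cast_injective.tendsto_cofinite)

theorem tendsto_rieszMoment_neg (A : X →L[ℂ] X) :
    Filter.Tendsto (fun n : ℕ => rieszMoment A (-(n : ℤ) - 1)) Filter.atTop (nhds 0) := by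
  rw [← Nat.cofinite_eq_atTop]
  refine (tendsto_rieszMoment A).comp (Function.Injective.tendsto_cofinite ?_)
  intro a b h
  simpa using h

/-- With `Pₙ` the moments and `P = P₀`, one has `P (P - 1) = P Aⁿ P₋ₙ = Pₙ P₋ₙ → 0`. -/
theorem HasDichotomy.isIdempotentElem_diskRieszProj (hA : HasDichotomy A) :
    IsIdempotentElem (diskRieszProj A) := by
  have h1 : ∀ n : ℕ, rieszMoment A (n + 1 : ℕ) * rieszMoment A (-(n : ℤ) - 1) =
      diskRieszProj A * (diskRieszProj A - 1) := by
    intro n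
    rw [← hA.diskRieszProj_mul_pow, mul_assoc, hA.pow_mul_rieszMoment_neg]
  have h2 := ((Filter.tendsto_add_atTop_iff_nat 1).2 (tendsto_rieszMoment_nat A)).mul
    (tendsto_rieszMoment_neg A)
  simp only [h1, mul_zero] at h2
  have h3 := tendsto_nhds_unique h2 tendsto_const_nhds
  rw [mul_sub, mul_one] at h3
  exact (sub_eq_zero.1 h3.symm)

end Riesz

/-! ### Sign of a solution of the Stein inequality on the two spectral subspaces of `A` -/

section Stein

variable {X : Type*} [NormedAddCommGroup X] [InnerProductSpace ℂ X] [CompleteSpace X]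
  {A H : X →L[ℂ] X}

omit [CompleteSpace X] in
theorem tendsto_quadForm_zero (H : X →L[ℂ] X) {x : ℕ → X}
    (hx : Filter.Tendsto x Filter.atTop (nhds 0)) :
    Filter.Tendsto (fun n => (⟪H (x n), x n⟫_ℂ).re) Filter.atTop (nhds 0) := by
  have h : Continuous fun y : X => (⟪H y, y⟫_ℂ).re := by fun_prop
  have h0 := (h.tendsto 0).comp hx
  rw [map_zero, inner_zero_left, Complex.zero_re] at h0
  exact h0

/-- The form `⟨Hx, x⟩` decreases along forward orbits, and those starting in the spectral subspace
over the disk tend to zero. -/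
theorem HasDichotomy.quadForm_ge_of_stein (hA : HasDichotomy A) {δ : ℝ} (hδ : 0 ≤ δ)
    (hS : ∀ x, (⟪H (A x), A x⟫_ℂ).re + δ * ‖x‖ ^ 2 ≤ (⟪H x, x⟫_ℂ).re)
    {x : X} (hx : x ∈ spectralSubspaceDisk A) : δ * ‖x‖ ^ 2 ≤ (⟪H x, x⟫_ℂ).re := by
  obtain ⟨y, rfl⟩ := hx
  set x : X := diskRieszProj A y
  change δ * ‖x‖ ^ 2 ≤ (⟪H x, x⟫_ℂ).re
  have ht : Filter.Tendsto (fun n : ℕ => (A ^ (n + 1)) x) Filter.atTop (nhds 0) := by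
    have h := ((ContinuousLinearMap.apply ℂ X y).continuous.tendsto 0).comp
      ((Filter.tendsto_add_atTop_iff_nat 1).2 (tendsto_rieszMoment_nat A))
    rw [map_zero] at h
    refine h.congr fun n => ?_
    rw [Function.comp_apply, ← hA.pow_mul_diskRieszProj]; rfl
  have hle : ∀ n : ℕ, (⟪H ((A ^ (n + 1)) x), (A ^ (n + 1)) x⟫_ℂ).re + δ * ‖x‖ ^ 2 ≤
      (⟪H x, x⟫_ℂ).re := by
    intro n
    induction n with
    | zero => simpa using hS x
    | succ n ih =>
      have := hS ((A ^ (n + 1)) x)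
      have e : (A ^ (n + 1 + 1)) x = A ((A ^ (n + 1)) x) := by rw [pow_succ']; rfl
      rw [e]
      nlinarith [sq_nonneg ‖(A ^ (n + 1)) x‖, mul_nonneg hδ (sq_nonneg ‖(A ^ (n + 1)) x‖)]
  have hlim := (tendsto_quadForm_zero H ht).add_const (δ * ‖x‖ ^ 2)
  rw [zero_add] at hlim
  exact le_of_tendsto' hlim hle

/-- Every point of the exterior spectral subspace has a backward orbit tending to zero, along
which `⟨Hx, x⟩` increases. -/
theorem HasDichotomy.quadForm_le_of_stein (hA : HasDichotomy A) {δ : ℝ} (hδ : 0 ≤ δ)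
    (hS : ∀ x, (⟪H (A x), A x⟫_ℂ).re + δ * ‖x‖ ^ 2 ≤ (⟪H x, x⟫_ℂ).re)
    {x : X} (hx : x ∈ spectralSubspaceExterior A) :
    (⟪H x, x⟫_ℂ).re ≤ -(δ / (‖A‖ ^ 2 + 1) * ‖x‖ ^ 2) := by
  have hxP : x = x - diskRieszProj A x := by
    obtain ⟨y, rfl⟩ := hx
    have : diskRieszProj A * (1 - diskRieszProj A) = 0 :=
      hA.isIdempotentElem_diskRieszProj.mul_one_sub_self
    have h2 : diskRieszProj A ((1 - diskRieszProj A) y) = 0 :=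
      congrArg (fun T : X →L[ℂ] X => T y) this
    change _ = _ - diskRieszProj A ((1 - diskRieszProj A) y)
    rw [h2, sub_zero]
  set b : ℕ → X := fun n => rieszMoment A (-(n : ℤ) - 1) x with hb
  have ht : Filter.Tendsto b Filter.atTop (nhds 0) := by
    have h := ((ContinuousLinearMap.apply ℂ X x).continuous.tendsto 0).comp
      (tendsto_rieszMoment_neg A)
    rwa [map_zero] at h
  have hb0 : A (b 0) = -x := by
    have h := congrArg (fun T : X →L[ℂ] X => T x) hA.mul_rieszMoment_neg_one
    have h' : A (rieszMoment A (-1) x) = diskRieszProj A x - x := h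
    rw [hb]
    simp only [Nat.cast_zero, neg_zero, zero_sub]
    rw [h']
    nth_rewrite 3 [hxP]
    abel
  have hbs : ∀ n, A (b (n + 1)) = b n := fun n =>
    congrArg (fun T : X →L[ℂ] X => T x) (hA.mul_rieszMoment_neg n)
  have hle : ∀ n, (⟪H x, x⟫_ℂ).re + δ * ‖b 0‖ ^ 2 ≤ (⟪H (b n), b n⟫_ℂ).re := by
    intro n
    induction n with
    | zero =>
      have := hS (b 0)
      rw [hb0] at this
      simpa using this
    | succ n ih =>
      have := hS (b (n + 1))
      rw [hbs] at this
      nlinarith [mul_nonneg hδ (sq_nonneg ‖b (n + 1)‖)]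
  have h1 := ge_of_tendsto' (tendsto_quadForm_zero H ht) hle
  have h2 : ‖x‖ ≤ ‖A‖ * ‖b 0‖ := by
    have := A.le_opNorm (b 0)
    rwa [hb0, norm_neg] at this
  have h3 : ‖x‖ ^ 2 ≤ (‖A‖ ^ 2 + 1) * ‖b 0‖ ^ 2 := by
    calc ‖x‖ ^ 2 ≤ (‖A‖ * ‖b 0‖) ^ 2 := by gcongr
      _ ≤ _ := by nlinarith [sq_nonneg ‖b 0‖]
  have h4 : δ / (‖A‖ ^ 2 + 1) * ‖x‖ ^ 2 ≤ δ * ‖b 0‖ ^ 2 := by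
    rw [div_mul_eq_mul_div, div_le_iff₀ (by positivity), mul_assoc, mul_comm (‖b 0‖ ^ 2)]
    gcongr
  linarith

end Stein

/-! ### Hilbert space dimension -/

section HilbertDim

universe u

variable {E F : Type u} [NormedAddCommGroup E] [InnerProductSpace ℂ E] [CompleteSpace E]
  [NormedAddCommGroup F] [InnerProductSpace ℂ F] [CompleteSpace F]

omit [CompleteSpace E] in
theorem exists_hilbertBasis_of_linearIsometryEquiv (e : E ≃ₗᵢ[ℂ] F) (c : Cardinal)
    (h : ∃ w : Set E, Nonempty (HilbertBasis w ℂ E) ∧ Cardinal.mk w = c) :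
    ∃ w : Set F, Nonempty (HilbertBasis w ℂ F) ∧ Cardinal.mk w = c := by
  obtain ⟨w, ⟨b⟩, rfl⟩ := h
  let σ : w ≃ (e '' w : Set F) := Equiv.Set.image e w e.injective
  refine ⟨e '' w, ⟨HilbertBasis.mkOfOrthogonalEqBot (v := fun i => e (b (σ.symm i))) ?_ ?_⟩,
    Cardinal.mk_congr σ.symm⟩
  · exact (b.orthonormal.comp _ σ.symm.injective).comp_linearIsometry e.toLinearIsometry
  · rw [eq_bot_iff]
    intro y hy
    rw [Submodule.mem_orthogonal] at hy
    have hz : ∀ i, ⟪b i, e.symm y⟫_ℂ = 0 := by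
      intro i
      have := hy (e (b i)) (Submodule.subset_span ⟨σ i, by simp⟩)
      rwa [← e.symm.inner_map_map, e.symm_apply_apply] at this
    have h0 : b.repr (e.symm y) = 0 := by
      ext i
      rw [b.repr_apply_apply, hz]; rfl
    have : e.symm y = 0 := by simpa using h0
    simpa using this

theorem hilbertDim_eq_of_linearIsometryEquiv (e : E ≃ₗᵢ[ℂ] F) : hilbertDim E = hilbertDim F := by
  rw [hilbertDim, hilbertDim]
  congr 1
  ext c
  exact ⟨exists_hilbertBasis_of_linearIsometryEquiv e c,
    exists_hilbertBasis_of_linearIsometryEquiv e.symm c⟩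

/-- Linearly homeomorphic Hilbert spaces are isometric: in the polar decomposition `T = V |T|` of
an isomorphism the factor `V = T |T|⁻¹` is unitary. -/
theorem exists_linearIsometryEquiv_of_continuousLinearEquiv (T : E ≃L[ℂ] F) :
    Nonempty (E ≃ₗᵢ[ℂ] F) := by
  set T' : E →L[ℂ] F := (T : E →L[ℂ] F) with hT'
  set S : E →L[ℂ] E := ContinuousLinearMap.adjoint T' ∘L T' with hS
  have hSpos : 0 ≤ S := (ContinuousLinearMap.nonneg_iff_isPositive S).2
    (ContinuousLinearMap.isPositive_adjoint_comp_self T')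
  have hSform : ∀ x, (⟪S x, x⟫_ℂ).re = ‖T x‖ ^ 2 := by
    intro x
    rw [hS, ContinuousLinearMap.comp_apply, ContinuousLinearMap.adjoint_inner_left,
      re_inner_self_eq_norm_sq]
    rfl
  have hSunit : IsUnit S := by
    obtain ⟨c, hc, h⟩ : ∃ c : ℝ, 0 < c ∧ ∀ x, ‖x‖ ≤ c * ‖T x‖ := by
      refine ⟨‖(T.symm : F →L[ℂ] E)‖ + 1, by positivity, fun x => ?_⟩
      have h1 := (T.symm : F →L[ℂ] E).le_opNorm (T x)
      simp only [ContinuousLinearEquiv.coe_coe, ContinuousLinearEquiv.symm_apply_apply] at h1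
      nlinarith [norm_nonneg (T x)]
    refine isUnit_of_coercive S (c := (c ^ 2)⁻¹) (by positivity) fun x => ?_
    rw [hSform, inv_mul_le_iff₀ (by positivity), ← mul_pow]
    gcongr
    exact h x
  set R : E →L[ℂ] E := CFC.sqrt S with hR
  have hRR : R * R = S := CFC.sqrt_mul_sqrt_self S hSpos
  have hRsa : IsSelfAdjoint R := IsSelfAdjoint.of_nonneg (CFC.sqrt_nonneg S)
  have hRnorm : ∀ x, ‖R x‖ = ‖T x‖ := by
    intro x
    have : ‖R x‖ ^ 2 = ‖T x‖ ^ 2 := by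
      rw [← hSform, ← hRR, mul_apply_eq_comp, inner_isSelfAdjoint hRsa, re_inner_self_eq_norm_sq]
    exact (pow_left_inj₀ (norm_nonneg _) (norm_nonneg _) two_ne_zero).1 this
  have hRunit : IsUnit R := by
    have hcomm : Commute R R := Commute.refl R
    exact (hcomm.isUnit_mul_iff.1 (hRR ▸ hSunit)).1
  obtain ⟨r, hr⟩ := hRunit
  have hbij := ContinuousLinearMap.isUnit_iff_bijective.1 ⟨r, hr⟩
  let e : E ≃ₗ[ℂ] E := LinearEquiv.ofBijective (R : E →ₗ[ℂ] E) hbij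
  refine ⟨⟨e.symm.trans T.toLinearEquiv, fun x => ?_⟩⟩
  obtain ⟨y, rfl⟩ := e.surjective x
  have h1 : e y = R y := rfl
  simp only [LinearEquiv.trans_apply, LinearEquiv.symm_apply_apply]
  rw [h1, hRnorm]
  rfl

theorem hilbertDim_eq_of_continuousLinearEquiv (T : E ≃L[ℂ] F) : hilbertDim E = hilbertDim F :=
  (exists_linearIsometryEquiv_of_continuousLinearEquiv T).elim
    hilbertDim_eq_of_linearIsometryEquiv

end HilbertDim

/-! ### Inertia of a definite splitting -/

section Inertia

variable {X : Type*} [NormedAddCommGroup X] [InnerProductSpace ℂ X] [CompleteSpace X]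
  {H P E : X →L[ℂ] X}

omit [CompleteSpace X] in
theorem IsIdempotentElem.mem_range_iff (hP : IsIdempotentElem P) {x : X} :
    x ∈ LinearMap.range (P : X →ₗ[ℂ] X) ↔ P x = x := by
  constructor
  · rintro ⟨y, rfl⟩
    exact congrArg (fun T : X →L[ℂ] X => T y) hP
  · exact fun h => ⟨x, h⟩

theorem IsIdempotentElem.completeSpace_range (hP : IsIdempotentElem P) :
    CompleteSpace (LinearMap.range (P : X →ₗ[ℂ] X)) := by
  have : (LinearMap.range (P : X →ₗ[ℂ] X) : Set X) = {x | P x = x} := by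
    ext x; exact hP.mem_range_iff
  have hcl : IsClosed (LinearMap.range (P : X →ₗ[ℂ] X) : Set X) := by
    rw [this]; exact isClosed_eq P.continuous continuous_id
  exact hcl.completeSpace_coe

/-- A selfadjoint operator that is uniformly positive on a closed subspace and uniformly negative
on a complement of it is invertible, as one sees by pairing `H (s + u)` with `s - u`. -/
theorem isUnit_of_definite_splitting (hH : IsSelfAdjoint H) {δ : ℝ} (hδ : 0 < δ)
    (hpos : ∀ x, δ * ‖P x‖ ^ 2 ≤ (⟪H (P x), P x⟫_ℂ).re)
    (hneg : ∀ x, (⟪H (x - P x), x - P x⟫_ℂ).re ≤ -(δ * ‖x - P x‖ ^ 2)) : IsUnit H := by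
  have hb : ∀ x, δ / 2 * ‖x‖ ≤ ‖H x‖ := by
    intro x
    set s := P x with hs
    set t := x - P x with ht
    have hx : x = s + t := by simp [hs, ht]
    have h1 : (⟪H (s + t), s - t⟫_ℂ).re = (⟪H s, s⟫_ℂ).re - (⟪H t, t⟫_ℂ).re := by
      have : (⟪H s, t⟫_ℂ).re = (⟪H t, s⟫_ℂ).re := by
        rw [inner_isSelfAdjoint hH s t, ← inner_conj_symm, Complex.conj_re]
      simp only [map_add, inner_add_left, inner_sub_right, Complex.add_re, Complex.sub_re]
      rw [this]; ring
    have h2 : (⟪H (s + t), s - t⟫_ℂ).re ≤ ‖H (s + t)‖ * (‖s‖ + ‖t‖) :=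
      ((Complex.re_le_norm _).trans (norm_inner_le_norm _ _)).trans
        (by gcongr; exact norm_sub_le _ _)
    have h3 : δ / 2 * (‖s‖ + ‖t‖) * (‖s‖ + ‖t‖) ≤ ‖H (s + t)‖ * (‖s‖ + ‖t‖) := by
      nlinarith [hpos x, hneg x, sq_nonneg (‖s‖ - ‖t‖)]
    rw [hx]
    rcases (add_nonneg (norm_nonneg s) (norm_nonneg t)).eq_or_lt with h0 | h0
    · have : ‖s + t‖ ≤ 0 := (norm_add_le s t).trans h0.symm.le
      nlinarith [norm_nonneg (H (s + t))]
    · have := le_of_mul_le_mul_right h3 h0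
      nlinarith [norm_add_le s t]
  refine ContinuousLinearMap.isUnit_iff_bijective.2
    (bijective_of_bounded_below_of_dense H (half_pos hδ) hb fun w hw => ?_)
  have h0 : H w = 0 := by
    rw [← inner_self_eq_zero (𝕜 := ℂ), ← inner_isSelfAdjoint hH]
    exact hw _
  have := hb w
  rw [h0, norm_zero] at this
  exact norm_le_zero_iff.1 (by nlinarith [norm_nonneg w])

/-- If `H` is uniformly positive on `Ran P` and uniformly negative on `Ran (1 - P)`, and `E` is an
orthogonal projection commuting with `H` that splits it into a nonnegative and a nonpositive part,
then `E` restricts to an isomorphism of `Ran P` onto `Ran E`. -/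
theorem hilbertDim_range_eq_of_definite_splitting (hH : IsSelfAdjoint H) (hHu : IsUnit H)
    (hP : IsIdempotentElem P) (hE : IsIdempotentElem E) (hEsa : IsSelfAdjoint E)
    (hEH : Commute E H) {δ : ℝ} (hδ : 0 < δ)
    (hpos : ∀ x, P x = x → δ * ‖x‖ ^ 2 ≤ (⟪H x, x⟫_ℂ).re)
    (hneg : ∀ x, P x = 0 → (⟪H x, x⟫_ℂ).re ≤ -(δ * ‖x‖ ^ 2))
    (hEpos : ∀ x, E x = x → 0 ≤ (⟪H x, x⟫_ℂ).re)
    (hEneg : ∀ x, E x = 0 → (⟪H x, x⟫_ℂ).re ≤ 0) :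
    hilbertDim (LinearMap.range (P : X →ₗ[ℂ] X)) =
      hilbertDim (LinearMap.range (E : X →ₗ[ℂ] X)) := by
  have := hP.completeSpace_range
  have := hE.completeSpace_range
  have hEE : ∀ x, E (E x) = E x := fun x => congrArg (fun T : X →L[ℂ] X => T x) hE
  have hPP : ∀ x, P (P x) = P x := fun x => congrArg (fun T : X →L[ℂ] X => T x) hP
  have hEHx : ∀ x, E (H x) = H (E x) := fun x => congrArg (fun T : X →L[ℂ] X => T x) hEH.eq
  let T : LinearMap.range (P : X →ₗ[ℂ] X) →L[ℂ] LinearMap.range (E : X →ₗ[ℂ] X) :=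
    (E ∘L (LinearMap.range (P : X →ₗ[ℂ] X)).subtypeL).codRestrict _ fun x => ⟨x, rfl⟩
  have hTx : ∀ x, ((T x : LinearMap.range (E : X →ₗ[ℂ] X)) : X) = E x := fun x => rfl
  -- `E` splits the form, so that `δ ‖x‖² ≤ ⟨Hx, x⟩ ≤ ⟨HEx, Ex⟩ ≤ ‖H‖ ‖Ex‖²` on `Ran P`.
  have hlow : ∀ x, P x = x → δ * ‖x‖ ^ 2 ≤ ‖H‖ * ‖E x‖ ^ 2 := by
    intro x hx
    have h1 := hpos x hx
    have h2 := hEneg (x - E x) (by rw [map_sub, hEE, sub_self])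
    have h3 : (⟪H (x - E x), x - E x⟫_ℂ).re = (⟪H x, x⟫_ℂ).re - (⟪H (E x), E x⟫_ℂ).re := by
      have e1 : ⟪H x, E x⟫_ℂ = ⟪H (E x), E x⟫_ℂ := by
        rw [← hEHx, inner_isSelfAdjoint hEsa, hEE]
      have e2 : ⟪H (E x), x⟫_ℂ = ⟪H (E x), E x⟫_ℂ := by
        rw [← inner_isSelfAdjoint hEsa, hEHx, hEE]
      simp only [map_sub, inner_sub_left, inner_sub_right, Complex.sub_re]
      rw [e1, e2]; ring
    have h4 : (⟪H (E x), E x⟫_ℂ).re ≤ ‖H‖ * ‖E x‖ ^ 2 := by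
      refine ((Complex.re_le_norm _).trans (norm_inner_le_norm _ _)).trans ?_
      rw [sq, ← mul_assoc]
      gcongr
      exact H.le_opNorm _
    linarith
  have hbij : Function.Bijective T := by
    have hK : 0 < ‖H‖ + δ := by positivity
    refine bijective_of_bounded_below_of_dense T (c := Real.sqrt (δ / (‖H‖ + δ)))
      (Real.sqrt_pos.2 (by positivity)) (fun x => ?_) (fun w hw => ?_)
    · have h1 := hlow x (hP.mem_range_iff.1 x.2)
      refine le_of_sq_le_sq ?_ (norm_nonneg _)
      rw [mul_pow, Real.sq_sqrt (by positivity), div_mul_eq_mul_div, div_le_iff₀ hK]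
      change δ * ‖(x : X)‖ ^ 2 ≤ ‖E x‖ ^ 2 * (‖H‖ + δ)
      nlinarith [mul_nonneg hδ.le (sq_nonneg ‖E x‖)]
    -- For `w` in `Ran E` orthogonal to `E (Ran P)`, the vector `y = H⁻¹ w` lies in `Ran E` and is
    -- `H`-orthogonal to `Ran P`; its component along `Ran (1 - P)` is both nonnegative and negative.
    · obtain ⟨hinj, hsurj⟩ := ContinuousLinearMap.isUnit_iff_bijective.1 hHu
      obtain ⟨y, hy⟩ := hsurj (w : X)
      have hEw : E (w : X) = w := hE.mem_range_iff.1 w.2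
      have hEy : E y = y := hinj (by rw [← hEHx, hy, hEw])
      have hort : ∀ x, P x = x → ⟪H y, x⟫_ℂ = 0 := by
        intro x hx
        have h1 : ⟪E x, (w : X)⟫_ℂ = 0 := hw ⟨x, hP.mem_range_iff.2 hx⟩
        rw [hy, ← inner_conj_symm, ← hEw, ← inner_isSelfAdjoint hEsa, h1, map_zero]
      have hs := hPP y
      have hu : P (y - P y) = 0 := by rw [map_sub, hs, sub_self]
      have h3 : (⟪H (y - P y), y - P y⟫_ℂ).re =
          (⟪H y, y⟫_ℂ).re + (⟪H (P y), P y⟫_ℂ).re := by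
        have e1 := hort (P y) hs
        have e2 : ⟪H (P y), y⟫_ℂ = 0 := by
          rw [inner_isSelfAdjoint hH, ← inner_conj_symm, e1, map_zero]
        simp only [map_sub, inner_sub_left, inner_sub_right, Complex.sub_re]
        rw [e1, e2]; simp
      have h4 := hneg _ hu
      have h5 := hpos _ hs
      have h6 := hEpos y hEy
      have h7 : ‖y - P y‖ ^ 2 ≤ 0 := by
        nlinarith [mul_nonneg hδ.le (sq_nonneg ‖P y‖), mul_nonneg hδ.le (sq_nonneg ‖y - P y‖)]
      have h8 : P y = y := by
        have : y - P y = 0 := by simpa using h7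
        exact (sub_eq_zero.1 this).symm
      have h9 := hpos y h8
      rw [hort y h8, Complex.zero_re] at h9
      have h10 : y = 0 := by
        have : ‖y‖ ^ 2 ≤ 0 := by nlinarith
        simpa using this
      apply Subtype.ext
      rw [← hy, h10, map_zero]; rfl
  exact hilbertDim_eq_of_continuousLinearEquiv
    (ContinuousLinearEquiv.ofBijective T (LinearMap.ker_eq_bot.2 hbij.1)
      (LinearMap.range_eq_top.2 hbij.2))

end Inertia

/-! ### The spectral projections of an invertible selfadjoint operator -/

section SpectralProjections

variable {X : Type*} [NormedAddCommGroup X] [InnerProductSpace ℂ X] [CompleteSpace X]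
  {H : X →L[ℂ] X}

omit [CompleteSpace X] in
theorem zero_notMem_spectrum_real (hHu : IsUnit H) : (0 : ℝ) ∉ spectrum ℝ H :=
  spectrum.zero_notMem_iff ℝ |>.2 hHu

open Classical in
theorem continuousOn_ite_of_zero_notMem {s : Set ℝ} (hs : (0 : ℝ) ∉ s) (a b : ℝ) :
    ContinuousOn (fun t : ℝ => if 0 < t then a else b) s := by
  intro t ht
  have ht0 : t ≠ 0 := fun h => hs (h ▸ ht)
  refine ContinuousAt.continuousWithinAt ?_
  rcases ht0.lt_or_gt with h | h
  · refine (continuousAt_const (y := b)).congr ?_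
    filter_upwards [gt_mem_nhds h] with r hr
    rw [if_neg hr.not_gt]
  · refine (continuousAt_const (y := a)).congr ?_
    filter_upwards [lt_mem_nhds h] with r hr
    rw [if_pos hr]

theorem quadForm_cfc_nonneg (hH : IsSelfAdjoint H) {f : ℝ → ℝ}
    (hf : ContinuousOn f (spectrum ℝ H)) (h : ∀ t ∈ spectrum ℝ H, 0 ≤ t * f t) (x : X) :
    0 ≤ (⟪H (cfc f H x), x⟫_ℂ).re := by
  have h1 : H * cfc f H = cfc (fun t => t * f t) H := by
    rw [cfc_mul (fun t => t) f H continuousOn_id hf, cfc_id' ℝ H]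
  have h2 : 0 ≤ H * cfc f H := h1 ▸ cfc_nonneg h
  have h3 := ((ContinuousLinearMap.nonneg_iff_isPositive _).1 h2).re_inner_nonneg_left x
  exact h3

open Classical in
/-- The spectral projection `χ(H)` of `H` for the positive half line. -/
noncomputable def posSpectralProj (H : X →L[ℂ] X) : X →L[ℂ] X :=
  cfc (fun t : ℝ => if 0 < t then (1 : ℝ) else 0) H

theorem isIdempotentElem_posSpectralProj (hHu : IsUnit H) :
    IsIdempotentElem (posSpectralProj H) := by
  classical
  have hc := continuousOn_ite_of_zero_notMem (zero_notMem_spectrum_real hHu) 1 0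
  rw [IsIdempotentElem, posSpectralProj, ← cfc_mul _ _ H hc hc]
  congr 1
  ext t
  split_ifs <;> simp

theorem commute_posSpectralProj (hH : IsSelfAdjoint H) : Commute (posSpectralProj H) H :=
  hH.commute_cfc (Commute.refl H) _

theorem quadForm_posSpectralProj_nonneg (hH : IsSelfAdjoint H) (hHu : IsUnit H) {x : X}
    (hx : posSpectralProj H x = x) : 0 ≤ (⟪H x, x⟫_ℂ).re := by
  classical
  have hc := continuousOn_ite_of_zero_notMem (zero_notMem_spectrum_real hHu) 1 0
  have := quadForm_cfc_nonneg hH hc (fun t _ => by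
    split_ifs with h
    exacts [by simpa using h.le, by simp]) x
  rw [posSpectralProj] at hx
  rwa [hx] at this

theorem one_sub_posSpectralProj (hH : IsSelfAdjoint H) (hHu : IsUnit H) :
    1 - posSpectralProj H = cfc (fun t : ℝ => if 0 < t then (0 : ℝ) else 1) H := by
  classical
  have hc := continuousOn_ite_of_zero_notMem (zero_notMem_spectrum_real hHu) 1 0
  rw [posSpectralProj, ← cfc_one ℝ H, ← cfc_sub 1 _ H continuousOn_const hc]
  congr 1
  ext t
  simp only [Pi.one_apply]
  split_ifs <;> simp

theorem quadForm_posSpectralProj_nonpos (hH : IsSelfAdjoint H) (hHu : IsUnit H) {x : X}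
    (hx : posSpectralProj H x = 0) : (⟪H x, x⟫_ℂ).re ≤ 0 := by
  classical
  have hc := continuousOn_ite_of_zero_notMem (zero_notMem_spectrum_real hHu) 0 (-1)
  have h1 := quadForm_cfc_nonneg hH hc
    (fun t _ => by split_ifs with h <;> simp; exact not_lt.1 h) x
  have h2 : cfc (fun t : ℝ => if 0 < t then (0 : ℝ) else -1) H = -(1 - posSpectralProj H) := by
    rw [one_sub_posSpectralProj hH hHu, ← cfc_neg]
    congr 1
    ext t
    split_ifs <;> simp
  rw [h2] at h1
  simp only [neg_apply, sub_apply, one_apply_eq_self, hx, sub_zero, map_neg, inner_neg_left,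
    Complex.neg_re] at h1
  linarith

theorem spectralSubspaceNeg_eq_range (hH : IsSelfAdjoint H) (hHu : IsUnit H) :
    spectralSubspaceNeg H = LinearMap.range ((1 - posSpectralProj H : X →L[ℂ] X) : X →ₗ[ℂ] X) := by
  rw [one_sub_posSpectralProj hH hHu, spectralSubspaceNeg]
  congr 2
  refine cfc_congr fun t ht => ?_
  have ht0 : t ≠ 0 := fun h => zero_notMem_spectrum_real hHu (h ▸ ht)
  rcases ht0.lt_or_gt with h | h
  · simp [h, h.not_gt]
  · simp [h, h.not_gt]

end SpectralProjections

/-! ### Inertia of the solutions of the strict KYP inequality -/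

section KYPInertia

variable {X U Y : Type*}
  [NormedAddCommGroup X] [InnerProductSpace ℂ X] [CompleteSpace X]
  [NormedAddCommGroup U] [InnerProductSpace ℂ U] [CompleteSpace U]
  [NormedAddCommGroup Y] [InnerProductSpace ℂ Y] [CompleteSpace Y]

/-- A strict solution of the Stein inequality is definite on the range and on the kernel of the
Riesz projection, with a common constant. -/
theorem HasDichotomy.exists_definite_splitting {A H : X →L[ℂ] X} (hA : HasDichotomy A) {δ : ℝ}
    (hδ : 0 < δ) (hS : ∀ x, (⟪H (A x), A x⟫_ℂ).re + δ * ‖x‖ ^ 2 ≤ (⟪H x, x⟫_ℂ).re) :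
    ∃ ε : ℝ, 0 < ε ∧ (∀ x, diskRieszProj A x = x → ε * ‖x‖ ^ 2 ≤ (⟪H x, x⟫_ℂ).re) ∧
      ∀ x, diskRieszProj A x = 0 → (⟪H x, x⟫_ℂ).re ≤ -(ε * ‖x‖ ^ 2) := by
  refine ⟨δ / (‖A‖ ^ 2 + 1), by positivity, fun x hx => ?_, fun x hx => ?_⟩
  · refine le_trans ?_ (hA.quadForm_ge_of_stein hδ.le hS ⟨x, hx⟩)
    gcongr
    exact div_le_self hδ.le (by nlinarith [sq_nonneg ‖A‖])
  · exact hA.quadForm_le_of_stein hδ.le hS ⟨x, by simp [hx]⟩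

theorem DTSystem.inertiaMatches_of_strictKYP (S : DTSystem X U Y) (hA : HasDichotomy S.A)
    {H : X →L[ℂ] X} (hH : IsSelfAdjoint H) (hHu : IsUnit H) (hK : S.StrictKYP H) :
    InertiaMatches S.A H := by
  obtain ⟨δ, hδ, h⟩ := (S.strictKYP_iff hH).1 hK
  obtain ⟨ε, hε, hpos, hneg⟩ := hA.exists_definite_splitting (H := H) hδ fun x => by
    have := h x 0
    simp only [map_zero, add_zero, norm_zero] at this
    nlinarith [sq_nonneg ‖S.C x‖]
  have hP := hA.isIdempotentElem_diskRieszProj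
  have hE := isIdempotentElem_posSpectralProj hHu
  have hEsa : IsSelfAdjoint (posSpectralProj H) := cfc_predicate _ H
  have hEH := commute_posSpectralProj hH
  refine ⟨?_, ?_⟩
  · exact hilbertDim_range_eq_of_definite_splitting hH hHu hP hE hEsa hEH hε hpos hneg
      (fun x => quadForm_posSpectralProj_nonneg hH hHu)
      (fun x => quadForm_posSpectralProj_nonpos hH hHu)
  · rw [spectralSubspaceNeg_eq_range hH hHu]
    have h1 : ∀ (Q : X →L[ℂ] X) (x : X), (1 - Q) x = x ↔ Q x = 0 := by
      intro Q x; simp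
    have h0 : ∀ (Q : X →L[ℂ] X) (x : X), (1 - Q) x = 0 ↔ Q x = x := by
      intro Q x
      rw [sub_apply, one_apply_eq_self, sub_eq_zero, eq_comm]
    refine hilbertDim_range_eq_of_definite_splitting (H := -H) hH.neg hHu.neg hP.one_sub
      hE.one_sub ((IsSelfAdjoint.one _).sub hEsa)
      (((Commute.one_left H).sub_left hEH).neg_right) hε
      (fun x hx => ?_) (fun x hx => ?_) (fun x hx => ?_) (fun x hx => ?_) <;>
      simp only [h1, h0] at hx <;>
      simp only [neg_apply, inner_neg_left, Complex.neg_re]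
    · linarith [hneg x hx]
    · linarith [hpos x hx]
    · linarith [quadForm_posSpectralProj_nonpos hH hHu hx]
    · linarith [quadForm_posSpectralProj_nonneg hH hHu hx]

end KYPInertia

/-! ### From the frequency domain to finitely supported trajectories -/

section Frequency

variable {X U Y : Type*}
  [NormedAddCommGroup X] [InnerProductSpace ℂ X] [CompleteSpace X]
  [NormedAddCommGroup U] [InnerProductSpace ℂ U]
  [NormedAddCommGroup Y] [InnerProductSpace ℂ Y]

/-- The frequency domain form of the strict norm bound: at each frequency the defect
`d = ωx - Ax - Bu` of the state equation is penalized with a large constant. -/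
theorem DTSystem.exists_frequency_inequality (S : DTSystem X U Y) (hA : HasDichotomy S.A)
    (hS : S.transferSupNorm < 1) :
    ∃ ε κ : ℝ, 0 < ε ∧ 0 < κ ∧ ∀ ω : ℂ, ‖ω‖ = 1 → ∀ (x : X) (u : U),
      ‖S.C x + S.D u‖ ^ 2 + ε * (‖x‖ ^ 2 + ‖u‖ ^ 2) ≤
        ‖u‖ ^ 2 + κ * ‖ω • x - (S.A x + S.B u)‖ ^ 2 := by
  obtain ⟨M, hM0, hM⟩ := hA.exists_resolvent_bound
  set γ := S.transferSupNorm.toReal with hγ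
  have hγ1 : γ < 1 := by
    have := (ENNReal.toReal_lt_toReal hS.ne_top ENNReal.one_ne_top).2 hS
    simpa using this
  have hγ0 : 0 ≤ γ := ENNReal.toReal_nonneg
  have hF : ∀ ω : ℂ, ‖ω‖ = 1 → ‖S.transferFunction ω⁻¹‖ ≤ γ := by
    intro ω hω
    have h := enorm_transferFunction_le S (z := ω⁻¹) (by simp [hω])
    have := ENNReal.toReal_mono hS.ne_top h
    rwa [toReal_enorm] at this
  set b := M * ‖S.B‖ with hb
  set c := ‖S.C‖ * M with hc
  have h1γ : 0 < 1 - γ := by linarith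
  set ε := (1 - γ) / (2 * b ^ 2 + 1) with hε
  have hε0 : 0 < ε := by positivity
  have hεb : ε * (2 * b ^ 2 + 1) = 1 - γ := by rw [hε]; field_simp
  refine ⟨ε, c ^ 2 / (1 - γ) + 2 * ε * M ^ 2, hε0, by positivity, fun ω hω x u => ?_⟩
  set d := ω • x - (S.A x + S.B u) with hd
  have hx : x = resolvent S.A ω (S.B u + d) := by
    have := congrArg (fun T : X →L[ℂ] X => T x) (hA.resolvent_mul hω)
    simp only [mul_apply_eq_comp, sub_apply, smul_apply, one_apply_eq_self] at this
    have e : S.B u + d = ω • x - S.A x := by rw [hd]; abel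
    rw [e, map_sub, map_smul, this]; abel
  have hy : S.C x + S.D u = S.transferFunction ω⁻¹ u + S.C (resolvent S.A ω d) := by
    rw [hA.transferFunction_inv hω]
    nth_rewrite 1 [hx]
    simp only [map_add, add_apply, ContinuousLinearMap.comp_apply]
    abel
  have hRd : ∀ v, ‖resolvent S.A ω v‖ ≤ M * ‖v‖ := fun v =>
    (ContinuousLinearMap.le_opNorm _ _).trans (by gcongr; exact hM ω hω)
  have hyb : ‖S.C x + S.D u‖ ≤ γ * ‖u‖ + c * ‖d‖ := by
    rw [hy]
    refine (norm_add_le _ _).trans (add_le_add ?_ ?_)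
    · exact (ContinuousLinearMap.le_opNorm _ _).trans (by gcongr; exact hF ω hω)
    · refine (ContinuousLinearMap.le_opNorm _ _).trans ?_
      rw [hc, mul_assoc]
      gcongr
      exact hRd d
  have hxb : ‖x‖ ≤ b * ‖u‖ + M * ‖d‖ := by
    calc ‖x‖ = ‖resolvent S.A ω (S.B u + d)‖ := by rw [← hx]
      _ ≤ M * ‖S.B u + d‖ := hRd _
      _ ≤ M * (‖S.B‖ * ‖u‖ + ‖d‖) := by
          gcongr
          exact (norm_add_le _ _).trans (add_le_add_left (S.B.le_opNorm u) _)
      _ = _ := by rw [hb]; ring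
  have h1 : ‖S.C x + S.D u‖ ^ 2 ≤ γ * ‖u‖ ^ 2 + c ^ 2 / (1 - γ) * ‖d‖ ^ 2 := by
    have e : γ * ‖u‖ ^ 2 + c ^ 2 / (1 - γ) * ‖d‖ ^ 2 - (γ * ‖u‖ + c * ‖d‖) ^ 2 =
        γ / (1 - γ) * ((1 - γ) * ‖u‖ - c * ‖d‖) ^ 2 := by
      field_simp
      ring
    have e2 : 0 ≤ γ / (1 - γ) * ((1 - γ) * ‖u‖ - c * ‖d‖) ^ 2 := by positivity
    have e3 : ‖S.C x + S.D u‖ ^ 2 ≤ (γ * ‖u‖ + c * ‖d‖) ^ 2 := by gcongr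
    linarith
  have h2 : ‖x‖ ^ 2 ≤ 2 * b ^ 2 * ‖u‖ ^ 2 + 2 * M ^ 2 * ‖d‖ ^ 2 := by
    have e3 : ‖x‖ ^ 2 ≤ (b * ‖u‖ + M * ‖d‖) ^ 2 := by gcongr
    nlinarith [sq_nonneg (b * ‖u‖ - M * ‖d‖)]
  calc ‖S.C x + S.D u‖ ^ 2 + ε * (‖x‖ ^ 2 + ‖u‖ ^ 2)
      ≤ (γ * ‖u‖ ^ 2 + c ^ 2 / (1 - γ) * ‖d‖ ^ 2) +
        ε * ((2 * b ^ 2 * ‖u‖ ^ 2 + 2 * M ^ 2 * ‖d‖ ^ 2) + ‖u‖ ^ 2) := by gcongr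
    _ = (γ + ε * (2 * b ^ 2 + 1)) * ‖u‖ ^ 2 +
        (c ^ 2 / (1 - γ) + 2 * ε * M ^ 2) * ‖d‖ ^ 2 := by ring
    _ = _ := by rw [hεb]; ring

end Frequency

section Parseval

variable {E : Type*} [NormedAddCommGroup E] [InnerProductSpace ℂ E]

/-- Parseval's identity for the discrete Fourier transform of a vector valued sequence. -/
theorem IsPrimitiveRoot.sum_norm_sq_dft {ζ : ℂ} {N : ℕ} (hζ : IsPrimitiveRoot ζ N) (hN : N ≠ 0)
    (x : ℕ → E) :
    ∑ k ∈ Finset.range N, ‖∑ n ∈ Finset.range N, (ζ ^ k) ^ n • x n‖ ^ 2 =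
      N * ∑ n ∈ Finset.range N, ‖x n‖ ^ 2 := by
  have hz1 : ‖ζ‖ = 1 := hζ.norm'_eq_one hN
  have hz0 : ζ ≠ 0 := hζ.ne_zero hN
  have horth : ∀ n ∈ Finset.range N, ∀ m ∈ Finset.range N,
      ∑ k ∈ Finset.range N, (starRingEnd ℂ) ((ζ ^ k) ^ n) * (ζ ^ k) ^ m =
        if n = m then (N : ℂ) else 0 := by
    intro n hn m hm
    have h1 : ∀ k, (starRingEnd ℂ) ((ζ ^ k) ^ n) * (ζ ^ k) ^ m = (ζ ^ m / ζ ^ n) ^ k := by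
      intro k
      rw [← Complex.inv_eq_conj (by simp [hz1]), div_pow, div_eq_inv_mul]
      simp only [← pow_mul, mul_comm]
    simp only [h1]
    split_ifs with h
    · subst h; simp [hz0]
    · set q := ζ ^ m / ζ ^ n
      have hq : q ≠ 1 := by
        intro hq
        rw [div_eq_one_iff_eq (pow_ne_zero _ hz0)] at hq
        exact h (hζ.pow_inj (Finset.mem_range.1 hm) (Finset.mem_range.1 hn) hq).symm
      have hqN : q ^ N = 1 := by
        rw [div_pow, ← pow_mul, ← pow_mul, mul_comm, pow_mul, mul_comm n, pow_mul ζ N n,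
          hζ.pow_eq_one]
        simp
      have := mul_geom_sum q N
      rw [hqN, sub_self] at this
      exact (mul_eq_zero.1 this).resolve_left (sub_ne_zero.2 hq)
  have hC : (∑ k ∈ Finset.range N, ‖∑ n ∈ Finset.range N, (ζ ^ k) ^ n • x n‖ ^ 2 : ℂ) =
      N * ∑ n ∈ Finset.range N, (‖x n‖ : ℂ) ^ 2 := by
    have h2 : ∀ v : E, (‖v‖ : ℂ) ^ 2 = ⟪v, v⟫_ℂ := fun v => (inner_self_eq_norm_sq_to_K v).symm
    simp only [h2, sum_inner, inner_sum, inner_smul_left, inner_smul_right]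
    rw [Finset.sum_comm, Finset.mul_sum]
    refine Finset.sum_congr rfl fun n hn => ?_
    simp only [Finset.mul_sum]
    rw [Finset.sum_comm]
    have h3 : ∀ m ∈ Finset.range N, ∑ k ∈ Finset.range N,
        (ζ ^ k) ^ n * ((starRingEnd ℂ) ((ζ ^ k) ^ m) * ⟪x m, x n⟫_ℂ) =
          if m = n then N * ⟪x m, x n⟫_ℂ else 0 := by
      intro m hm
      rw [← ite_zero_mul, ← horth m hm n hn, Finset.sum_mul]
      exact Finset.sum_congr rfl fun k _ => by ring
    rw [Finset.sum_congr rfl h3, Finset.sum_ite_eq', if_pos hn]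
  exact_mod_cast hC

end Parseval

section Trajectories

variable {X U Y : Type*}
  [NormedAddCommGroup X] [InnerProductSpace ℂ X]
  [NormedAddCommGroup U] [InnerProductSpace ℂ U]
  [NormedAddCommGroup Y] [InnerProductSpace ℂ Y]

/-- For a finite sequence with vanishing end states the shift acts on the discrete Fourier
transform as multiplication by a unimodular number, which turns the frequency domain inequality
into a time domain one. -/
theorem DTSystem.sum_le_of_frequency_inequality (S : DTSystem X U Y) {ε κ : ℝ}
    (h : ∀ ω : ℂ, ‖ω‖ = 1 → ∀ (x : X) (u : U),
      ‖S.C x + S.D u‖ ^ 2 + ε * (‖x‖ ^ 2 + ‖u‖ ^ 2) ≤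
        ‖u‖ ^ 2 + κ * ‖ω • x - (S.A x + S.B u)‖ ^ 2)
    {N : ℕ} (x : ℕ → X) (u : ℕ → U) (hx0 : x 0 = 0) (hxN : x N = 0) :
    ∑ n ∈ Finset.range N, (‖S.C (x n) + S.D (u n)‖ ^ 2 + ε * (‖x n‖ ^ 2 + ‖u n‖ ^ 2)) ≤
      ∑ n ∈ Finset.range N, (‖u n‖ ^ 2 + κ * ‖x (n + 1) - (S.A (x n) + S.B (u n))‖ ^ 2) := by
  rcases Nat.eq_zero_or_pos N with rfl | hN
  · simp
  obtain ⟨ζ, hζ⟩ : ∃ ζ : ℂ, IsPrimitiveRoot ζ N := ⟨_, Complex.isPrimitiveRoot_exp N hN.ne'⟩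
  have hz1 : ‖ζ‖ = 1 := hζ.norm'_eq_one hN.ne'
  have hk : ∀ k ∈ Finset.range N,
      ‖∑ n ∈ Finset.range N, (ζ ^ k) ^ n • (S.C (x n) + S.D (u n))‖ ^ 2 +
        ε * (‖∑ n ∈ Finset.range N, (ζ ^ k) ^ n • x n‖ ^ 2 +
          ‖∑ n ∈ Finset.range N, (ζ ^ k) ^ n • u n‖ ^ 2) ≤
      ‖∑ n ∈ Finset.range N, (ζ ^ k) ^ n • u n‖ ^ 2 +
        κ * ‖∑ n ∈ Finset.range N, (ζ ^ k) ^ n • (x (n + 1) - (S.A (x n) + S.B (u n)))‖ ^ 2 := by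
    intro k _
    set z := ζ ^ k with hz
    have hzn : ‖z‖ = 1 := by simp [hz, hz1]
    have hz0 : z ≠ 0 := by intro h0; simp [h0] at hzn
    have hshift : z⁻¹ • ∑ n ∈ Finset.range N, z ^ n • x n =
        ∑ n ∈ Finset.range N, z ^ n • x (n + 1) := by
      rw [inv_smul_eq_iff₀ hz0]
      have h1 := Finset.sum_range_succ (fun n => z ^ n • x n) N
      rw [Finset.sum_range_succ', hx0, hxN] at h1
      simp only [smul_zero, add_zero] at h1
      rw [← h1, Finset.smul_sum]
      exact Finset.sum_congr rfl fun n _ => by rw [smul_smul, pow_succ']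
    have h2 := h z⁻¹ (by simp [hzn]) (∑ n ∈ Finset.range N, z ^ n • x n)
      (∑ n ∈ Finset.range N, z ^ n • u n)
    rw [hshift] at h2
    simpa only [map_sum, map_smul, smul_add, smul_sub, Finset.sum_add_distrib,
      Finset.sum_sub_distrib] using h2
  have hsum := Finset.sum_le_sum hk
  simp only [Finset.sum_add_distrib, ← Finset.mul_sum, hζ.sum_norm_sq_dft hN.ne'] at hsum
  simp only [Finset.sum_add_distrib, ← Finset.mul_sum]
  have hNpos : (0 : ℝ) < N := by exact_mod_cast hN
  refine le_of_mul_le_mul_left ?_ hNpos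
  linarith

end Trajectories

/-! ### Partial maximization of a quadratic form -/

section Schur

variable {V X : Type*} [NormedAddCommGroup V] [InnerProductSpace ℂ V] [CompleteSpace V]
  [NormedAddCommGroup X] [InnerProductSpace ℂ X] [CompleteSpace X]

/-- Maximizing a bounded quadratic form over the fibres of a split surjection `π` yields a bounded
quadratic form, attained at each point, provided the form is uniformly negative on `ker π`. The
maximizer depends linearly on the base point, and the new form is a Schur complement. -/
theorem exists_fibrewise_max_quadForm {J : V →L[ℂ] V} (hJ : IsSelfAdjoint J) (π : V →L[ℂ] X)
    (e : X →L[ℂ] V) (he : ∀ x, π (e x) = x) {η : ℝ} (hη : 0 < η)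
    (hneg : ∀ v, π v = 0 → (⟪J v, v⟫_ℂ).re ≤ -(η * ‖v‖ ^ 2)) :
    ∃ H : X →L[ℂ] X, IsSelfAdjoint H ∧
      (∀ x, ∃ v, π v = x ∧ (⟪J v, v⟫_ℂ).re = (⟪H x, x⟫_ℂ).re) ∧
      ∀ v, (⟪J v, v⟫_ℂ).re ≤ (⟪H (π v), π v⟫_ℂ).re := by
  set K : Submodule ℂ V := LinearMap.ker (π : V →ₗ[ℂ] X) with hK
  have hKc : CompleteSpace K := (ContinuousLinearMap.isClosed_ker π).completeSpace_coe
  set ι : K →L[ℂ] V := K.subtypeL with hι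
  have hιπ : ∀ k, π (ι k) = 0 := fun k => k.2
  set N : K →L[ℂ] K := -(ContinuousLinearMap.adjoint ι ∘L J ∘L ι) with hN
  have hNu : IsUnit N := by
    refine isUnit_of_coercive N hη fun k => ?_
    have h1 := hneg (ι k) (hιπ k)
    have h2 : ⟪N k, k⟫_ℂ = -⟪J (ι k), ι k⟫_ℂ := by
      rw [hN, neg_apply, inner_neg_left, ContinuousLinearMap.comp_apply,
        ContinuousLinearMap.adjoint_inner_left]; rfl
    rw [h2, Complex.neg_re]
    have h3 : ‖ι k‖ = ‖k‖ := rfl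
    rw [h3] at h1
    linarith
  obtain ⟨n, hn⟩ := hNu
  have hNG : ∀ k, N ((↑n⁻¹ : K →L[ℂ] K) k) = k := by
    intro k
    have := congrArg (fun T : K →L[ℂ] K => T k) n.mul_inv
    rwa [hn] at this
  set m : X →L[ℂ] V :=
    e + ι ∘L (↑n⁻¹ : K →L[ℂ] K) ∘L ContinuousLinearMap.adjoint ι ∘L J ∘L e with hm
  have hπm : ∀ x, π (m x) = x := by
    intro x
    simp only [hm, add_apply, ContinuousLinearMap.comp_apply, map_add, hιπ, he, add_zero]
  have hort : ∀ x v, π v = 0 → ⟪J (m x), v⟫_ℂ = 0 := by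
    intro x v hv
    have h1 : ContinuousLinearMap.adjoint ι (J (m x)) = 0 := by
      set y := ContinuousLinearMap.adjoint ι (J (e x)) with hy
      have h2 := hNG y
      rw [hN, neg_apply, ContinuousLinearMap.comp_apply, ContinuousLinearMap.comp_apply] at h2
      have h3 : m x = e x + ι ((↑n⁻¹ : K →L[ℂ] K) y) := rfl
      rw [h3, map_add, map_add, ← hy]
      nth_rewrite 1 [← h2]
      abel
    have h4 : ⟪J (m x), ι ⟨v, hv⟩⟫_ℂ = 0 := by
      rw [← ContinuousLinearMap.adjoint_inner_left, h1, inner_zero_left]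
    exact h4
  have hform : ∀ x, ⟪(ContinuousLinearMap.adjoint m ∘L J ∘L m) x, x⟫_ℂ = ⟪J (m x), m x⟫_ℂ := by
    intro x
    rw [ContinuousLinearMap.comp_apply, ContinuousLinearMap.adjoint_inner_left]; rfl
  refine ⟨ContinuousLinearMap.adjoint m ∘L J ∘L m, hJ.adjoint_conj m,
    fun x => ⟨m x, hπm x, by rw [hform]⟩, fun v => ?_⟩
  rw [hform]
  set w := v - m (π v) with hw
  have hw0 : π w = 0 := by rw [hw, map_sub, hπm, sub_self]
  have hv : v = m (π v) + w := by rw [hw]; abel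
  have h1 := hort (π v) w hw0
  have h2 : ⟪J w, m (π v)⟫_ℂ = 0 := by
    rw [inner_isSelfAdjoint hJ, ← inner_conj_symm, h1, map_zero]
  have h3 : ⟪J v, v⟫_ℂ = ⟪J (m (π v)), m (π v)⟫_ℂ + ⟪J w, w⟫_ℂ := by
    nth_rewrite 1 2 [hv]
    simp only [map_add, inner_add_left, inner_add_right]
    rw [h1, h2]; ring
  rw [h3, Complex.add_re]
  nlinarith [hneg w hw0, mul_nonneg hη.le (sq_nonneg ‖w‖)]

end Schur

/-! ### Quadratic forms built from norms -/

section NormForm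

variable {V G₁ G₂ G₃ : Type*} [NormedAddCommGroup V] [InnerProductSpace ℂ V] [CompleteSpace V]
  [NormedAddCommGroup G₁] [InnerProductSpace ℂ G₁] [CompleteSpace G₁]
  [NormedAddCommGroup G₂] [InnerProductSpace ℂ G₂] [CompleteSpace G₂]
  [NormedAddCommGroup G₃] [InnerProductSpace ℂ G₃] [CompleteSpace G₃]

theorem isSelfAdjoint_adjoint_comp_self (T : V →L[ℂ] G₁) :
    IsSelfAdjoint (ContinuousLinearMap.adjoint T ∘L T) :=
  (ContinuousLinearMap.isPositive_adjoint_comp_self T).isSelfAdjoint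

theorem exists_isSelfAdjoint_quadForm_eq (T₁ : V →L[ℂ] G₁) (T₂ : V →L[ℂ] G₂) (T₃ : V →L[ℂ] G₃)
    (ε κ : ℝ) : ∃ J : V →L[ℂ] V, IsSelfAdjoint J ∧
      ∀ f, (⟪J f, f⟫_ℂ).re = ‖T₁ f‖ ^ 2 + ε * ‖f‖ ^ 2 - ‖T₂ f‖ ^ 2 - κ * ‖T₃ f‖ ^ 2 := by
  refine ⟨ContinuousLinearMap.adjoint T₁ ∘L T₁ + (ε : ℂ) • 1 -
    ContinuousLinearMap.adjoint T₂ ∘L T₂ - (κ : ℂ) • (ContinuousLinearMap.adjoint T₃ ∘L T₃),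
    ?_, fun f => ?_⟩
  · have hr : ∀ r : ℝ, IsSelfAdjoint (r : ℂ) := fun r => Complex.conj_ofReal r
    exact (((isSelfAdjoint_adjoint_comp_self T₁).add ((hr ε).smul (.one _))).sub
      (isSelfAdjoint_adjoint_comp_self T₂)).sub ((hr κ).smul (isSelfAdjoint_adjoint_comp_self T₃))
  · simp only [sub_apply, add_apply, smul_apply, one_apply_eq_self,
      ContinuousLinearMap.comp_apply, inner_sub_left, inner_add_left, inner_smul_left,
      ContinuousLinearMap.adjoint_inner_left, Complex.conj_ofReal, Complex.sub_re,
      Complex.add_re, Complex.re_ofReal_mul, re_inner_self_eq_norm_sq]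

end NormForm

/-! ### Operators on square summable sequences -/

section SequenceSpace

variable {E F : Type*} [NormedAddCommGroup E] [InnerProductSpace ℂ E]
  [NormedAddCommGroup F] [InnerProductSpace ℂ F]

omit [InnerProductSpace ℂ E] in
theorem memℓp_two_iff {f : ℕ → E} : Memℓp f 2 ↔ Summable fun n => ‖f n‖ ^ 2 := by
  rw [memℓp_gen_iff (by simp)]
  simp

omit [InnerProductSpace ℂ E] in
theorem lp_two_hasSum_norm_sq (f : lp (fun _ : ℕ => E) 2) :
    HasSum (fun n => ‖f n‖ ^ 2) (‖f‖ ^ 2) := by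
  have := lp.hasSum_norm (p := 2) (by simp) f
  simpa using this

theorem summable_norm_sq_map_comp (T : E →L[ℂ] F) {σ : ℕ → ℕ} (hσ : Function.Injective σ)
    (f : lp (fun _ : ℕ => E) 2) : Summable fun n => ‖T (f (σ n))‖ ^ 2 := by
  refine Summable.of_nonneg_of_le (fun _ => by positivity) (fun n => ?_)
    (((lp_two_hasSum_norm_sq f).summable.comp_injective hσ).mul_left (‖T‖ ^ 2))
  rw [Function.comp_apply, ← mul_pow]
  gcongr
  exact T.le_opNorm _

/-- The operator `(fₙ)ₙ ↦ (T f_{σ(n)})ₙ` on square summable sequences, for an injective `σ`. -/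
noncomputable def lpMapComp (T : E →L[ℂ] F) (σ : ℕ → ℕ) (hσ : Function.Injective σ) :
    lp (fun _ : ℕ => E) 2 →L[ℂ] lp (fun _ : ℕ => F) 2 :=
  LinearMap.mkContinuous
    { toFun := fun f => ⟨fun n => T (f (σ n)), memℓp_two_iff.2 (summable_norm_sq_map_comp T hσ f)⟩
      map_add' := fun f g => by ext n; exact map_add T _ _
      map_smul' := fun c f => by ext n; exact map_smul T _ _ }
    ‖T‖ fun f => by
      refine le_of_sq_le_sq ?_ (by positivity)
      rw [mul_pow]
      refine hasSum_le_of_sum_le (lp_two_hasSum_norm_sq _) fun s => ?_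
      calc ∑ n ∈ s, ‖T (f (σ n))‖ ^ 2 ≤ ∑ n ∈ s, ‖T‖ ^ 2 * ‖f (σ n)‖ ^ 2 := by
            refine Finset.sum_le_sum fun n _ => ?_
            rw [← mul_pow]
            gcongr
            exact T.le_opNorm _
        _ = ‖T‖ ^ 2 * ∑ m ∈ s.map ⟨σ, hσ⟩, ‖f m‖ ^ 2 := by
            rw [Finset.sum_map, Finset.mul_sum]; rfl
        _ ≤ ‖T‖ ^ 2 * ‖f‖ ^ 2 := by
            gcongr
            exact sum_le_hasSum _ (fun _ _ => by positivity) (lp_two_hasSum_norm_sq f)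

omit [InnerProductSpace ℂ E] in
theorem exists_lp_cons (a : E) (f : lp (fun _ : ℕ => E) 2) :
    ∃ g : lp (fun _ : ℕ => E) 2, g 0 = a ∧ ∀ n, g (n + 1) = f n := by
  refine ⟨⟨fun n => Nat.casesOn n a fun k => f k, memℓp_two_iff.2 ?_⟩, rfl, fun n => rfl⟩
  rw [← summable_nat_add_iff 1]
  exact (lp_two_hasSum_norm_sq f).summable

end SequenceSpace

/-! ### The value function of the regularized control problem -/

section Value

variable {X U Y : Type*}
  [NormedAddCommGroup X] [InnerProductSpace ℂ X]
  [NormedAddCommGroup U] [InnerProductSpace ℂ U]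
  [NormedAddCommGroup Y] [InnerProductSpace ℂ Y]

namespace DTSystem

/-- The stage payoff `‖Cx + Du‖² + ε ‖(x, u)‖² - ‖u‖² - κ ‖x' - Ax - Bu‖²` of a pair `(x, u)` with
successor state `x'`, where the state equation is imposed through a penalty only. -/
noncomputable def stagePayoff (S : DTSystem X U Y) (ε κ : ℝ) (v : WithLp 2 (X × U)) (x' : X) : ℝ :=
  ‖S.C v.fst + S.D v.snd‖ ^ 2 + ε * ‖v‖ ^ 2 - ‖v.snd‖ ^ 2 -
    κ * ‖x' - (S.A v.fst + S.B v.snd)‖ ^ 2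

theorem exists_payoff_operator [CompleteSpace X] [CompleteSpace U] [CompleteSpace Y]
    (S : DTSystem X U Y) (ε κ : ℝ) :
    ∃ J : lp (fun _ : ℕ => WithLp 2 (X × U)) 2 →L[ℂ] lp (fun _ : ℕ => WithLp 2 (X × U)) 2,
      IsSelfAdjoint J ∧
      ∀ f, HasSum (fun n => S.stagePayoff ε κ (f n) (f (n + 1)).fst) (⟪J f, f⟫_ℂ).re := by
  set p : WithLp 2 (X × U) →L[ℂ] X := WithLp.fstL 2 ℂ X U
  set q : WithLp 2 (X × U) →L[ℂ] U := WithLp.sndL 2 ℂ X U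
  set Ty := lpMapComp (S.C ∘L p + S.D ∘L q) id Function.injective_id
  set Tu := lpMapComp q id Function.injective_id
  set Td := lpMapComp p Nat.succ Nat.succ_injective -
    lpMapComp (S.A ∘L p + S.B ∘L q) id Function.injective_id
  obtain ⟨J, hJ, hform⟩ := exists_isSelfAdjoint_quadForm_eq Ty Tu Td ε κ
  refine ⟨J, hJ, fun f => ?_⟩
  rw [hform]
  exact (((lp_two_hasSum_norm_sq (Ty f)).add ((lp_two_hasSum_norm_sq f).mul_left ε)).sub
    (lp_two_hasSum_norm_sq (Tu f))).sub ((lp_two_hasSum_norm_sq (Td f)).mul_left κ)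

/-- Sequences starting at state zero are limits of finitely supported ones, to which the summed
frequency domain inequality applies. -/
theorem payoff_le_of_frequency_inequality (S : DTSystem X U Y) {ε κ : ℝ}
    (h : ∀ ω : ℂ, ‖ω‖ = 1 → ∀ (x : X) (u : U),
      ‖S.C x + S.D u‖ ^ 2 + ε * (‖x‖ ^ 2 + ‖u‖ ^ 2) ≤
        ‖u‖ ^ 2 + κ * ‖ω • x - (S.A x + S.B u)‖ ^ 2)
    {J : lp (fun _ : ℕ => WithLp 2 (X × U)) 2 →L[ℂ] lp (fun _ : ℕ => WithLp 2 (X × U)) 2}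
    (hJ : ∀ f, HasSum (fun n => S.stagePayoff (ε / 2) κ (f n) (f (n + 1)).fst) (⟪J f, f⟫_ℂ).re)
    {f : lp (fun _ : ℕ => WithLp 2 (X × U)) 2} (hf : (f 0).fst = 0) :
    (⟪J f, f⟫_ℂ).re ≤ -(ε / 2 * ‖f‖ ^ 2) := by
  set g : ℕ → lp (fun _ : ℕ => WithLp 2 (X × U)) 2 :=
    fun N => ∑ i ∈ Finset.range N, lp.single 2 i (f i) with hg
  have hgn : ∀ N n, g N n = if n < N then f n else 0 := by
    intro N n
    rw [hg]
    simp only [lp.coeFn_sum, Finset.sum_apply, lp.coeFn_single, Finset.sum_pi_single,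
      Finset.mem_range]
  have hlim : Filter.Tendsto g Filter.atTop (nhds f) :=
    (lp.hasSum_single (by simp) f).tendsto_sum_nat
  have hle : ∀ N, (⟪J (g N), g N⟫_ℂ).re ≤ -(ε / 2 * ‖g N‖ ^ 2) := by
    intro N
    have hz : ∀ n, N ≤ n → g N n = 0 := fun n hn => by rw [hgn, if_neg hn.not_gt]
    have h1 : (⟪J (g N), g N⟫_ℂ).re =
        ∑ n ∈ Finset.range N, S.stagePayoff (ε / 2) κ (g N n) (g N (n + 1)).fst := by
      refine (hJ (g N)).unique (hasSum_sum_of_ne_finset_zero fun n hn => ?_)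
      have hn' : N ≤ n := by simpa using hn
      rw [hz n hn', hz (n + 1) (by omega)]
      simp [stagePayoff]
    have h2 : ‖g N‖ ^ 2 = ∑ n ∈ Finset.range N, ‖g N n‖ ^ 2 := by
      refine (lp_two_hasSum_norm_sq (g N)).unique (hasSum_sum_of_ne_finset_zero fun n hn => ?_)
      rw [hz n (by simpa using hn)]
      simp
    have h0 : (g N 0).fst = 0 := by
      rw [hgn]; split_ifs
      · exact hf
      · rfl
    have h3 := S.sum_le_of_frequency_inequality h (N := N) (fun n => (g N n).fst)
      (fun n => (g N n).snd) h0 (by rw [hz N le_rfl]; rfl)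
    simp only [← norm_sq_withLp_prod] at h3
    rw [h1, h2, Finset.mul_sum, ← sub_nonpos, sub_neg_eq_add, ← Finset.sum_add_distrib]
    rw [← sub_nonpos, ← Finset.sum_sub_distrib] at h3
    refine le_trans (le_of_eq (Finset.sum_congr rfl fun n _ => ?_)) h3
    rw [stagePayoff]
    ring
  have hc1 : Continuous fun f : lp (fun _ : ℕ => WithLp 2 (X × U)) 2 => (⟪J f, f⟫_ℂ).re := by
    fun_prop
  have hc2 : Continuous fun f : lp (fun _ : ℕ => WithLp 2 (X × U)) 2 => -(ε / 2 * ‖f‖ ^ 2) := by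
    fun_prop
  exact le_of_tendsto_of_tendsto' ((hc1.tendsto f).comp hlim) ((hc2.tendsto f).comp hlim) hle

/-- The value function of the penalized problem solves the strict KYP inequality; it is invertible
because it is definite on the two spectral subspaces of `A`. -/
theorem exists_strictKYP [CompleteSpace X] [CompleteSpace U] [CompleteSpace Y]
    (S : DTSystem X U Y) (hA : HasDichotomy S.A)
    (hS : S.transferSupNorm < 1) :
    ∃ H : X →L[ℂ] X, IsSelfAdjoint H ∧ IsUnit H ∧ S.StrictKYP H := by
  obtain ⟨ε, κ, hε, -, hfreq⟩ := S.exists_frequency_inequality hA hS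
  obtain ⟨J, hJsa, hJ⟩ := S.exists_payoff_operator (ε / 2) κ
  set π : lp (fun _ : ℕ => WithLp 2 (X × U)) 2 →L[ℂ] X :=
    WithLp.fstL 2 ℂ X U ∘L lp.evalCLM ℂ (fun _ : ℕ => WithLp 2 (X × U)) 2 0 with hπ
  set e : X →L[ℂ] lp (fun _ : ℕ => WithLp 2 (X × U)) 2 :=
    lp.singleContinuousLinearMap ℂ (fun _ : ℕ => WithLp 2 (X × U)) 2 0 ∘L
      ((WithLp.prodContinuousLinearEquiv 2 ℂ X U).symm : (X × U) →L[ℂ] WithLp 2 (X × U)) ∘L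
        ContinuousLinearMap.inl ℂ X U with he
  have hπf : ∀ f, π f = (f 0).fst := fun f => rfl
  have hπe : ∀ x, π (e x) = x := by
    intro x
    rw [hπf, he]
    simp
  obtain ⟨H, hH, hatt, hmax⟩ := exists_fibrewise_max_quadForm hJsa π e hπe (half_pos hε)
    fun f hf => S.payoff_le_of_frequency_inequality hfreq hJ hf
  -- Prepending `(x, u)` to an optimal sequence for the state `Ax + Bu` gives the dissipation
  -- inequality.
  have hdiss : ∀ (x : X) (u : U), (⟪H (S.A x + S.B u), S.A x + S.B u⟫_ℂ).re +
      ‖S.C x + S.D u‖ ^ 2 + ε / 2 * (‖x‖ ^ 2 + ‖u‖ ^ 2) ≤ (⟪H x, x⟫_ℂ).re + ‖u‖ ^ 2 := by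
    intro x u
    obtain ⟨f, hf, hfH⟩ := hatt (S.A x + S.B u)
    obtain ⟨g, hg0, hg1⟩ := exists_lp_cons (WithLp.toLp 2 (x, u)) f
    have h1 := hmax g
    have h2 : (⟪J g, g⟫_ℂ).re = (⟪J f, f⟫_ℂ).re +
        S.stagePayoff (ε / 2) κ (g 0) (f 0).fst := by
      have h3 := (hasSum_nat_add_iff' 1).2 (hJ g)
      simp only [hg1] at h3
      have h4 := h3.unique (hJ f)
      simp at h4
      linarith
    rw [hπf] at h1 hf
    rw [h2, hfH, hf, hg0] at h1
    simp only [stagePayoff, norm_sq_withLp_prod, WithLp.toLp_fst, WithLp.toLp_snd, sub_self,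
      norm_zero] at h1
    nlinarith
  refine ⟨H, hH, ?_, (S.strictKYP_iff hH).2 ⟨ε / 2, half_pos hε, hdiss⟩⟩
  obtain ⟨δ, hδ, hpos, hneg⟩ := hA.exists_definite_splitting (H := H) (half_pos hε) fun x => by
    have := hdiss x 0
    simp only [map_zero, add_zero, norm_zero] at this
    nlinarith [sq_nonneg ‖S.C x‖]
  have hP := hA.isIdempotentElem_diskRieszProj
  have hPP : ∀ x, diskRieszProj S.A (diskRieszProj S.A x) = diskRieszProj S.A x := fun x =>
    congrArg (fun T : X →L[ℂ] X => T x) hP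
  exact isUnit_of_definite_splitting (P := diskRieszProj S.A) hH hδ (fun x => hpos _ (hPP x))
    fun x => hneg _ (by rw [map_sub, hPP, sub_self])

end DTSystem

end Value

/-! ### The strict bounded real lemma -/

theorem theorem7p2 {X U Y : Type*}
    [NormedAddCommGroup X] [InnerProductSpace ℂ X] [CompleteSpace X]
    [NormedAddCommGroup U] [InnerProductSpace ℂ U] [CompleteSpace U]
    [NormedAddCommGroup Y] [InnerProductSpace ℂ Y] [CompleteSpace Y]
    (S : DTSystem X U Y) (hA : HasDichotomy S.A) :
    (S.transferSupNorm < 1 ↔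
      ∃ H : X →L[ℂ] X, IsSelfAdjoint H ∧ IsUnit H ∧ S.StrictKYP H) ∧
    (∀ H : X →L[ℂ] X, IsSelfAdjoint H → IsUnit H → S.StrictKYP H → InertiaMatches S.A H) :=
  ⟨⟨S.exists_strictKYP hA, fun ⟨_, hH, _, hK⟩ => S.transferSupNorm_lt_one_of_strictKYP hA hH hK⟩,
    fun _ hH hHu hK => S.inertiaMatches_of_strictKYP hA hH hHu hK⟩
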